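/- Let $n\ge 1$, let $u_1,\dots,u_n$ be the coordinates of $\mathbb{R}^n$, regarded as the big cell $\{u_0=1\}$ of $\mathbb{RP}^n$, and let $\xi_1,\dots,\xi_n$ be the conjugate momenta, so that $(u,\xi)$ are Darboux coordinates on $T^*\mathbb{R}^n$. Let $\mathcal{A}=\bigoplus_{d\ge 0}\mathcal{A}^d=C^\infty(\mathbb{R}^n,\mathbb{C})\otimes\mathbb{C}[\xi_1,\dots,\xi_n]$ be the algebra of smooth complex-valued functions on $T^*\mathbb{R}^n$ that are polynomial along the cotangent fibres, graded by the degree in $\xi$, with the Poisson bracket $$\{\phi,\psi\}=\sum_{i=1}^n\Big(\frac{\partial\phi}{\partial\xi_i}\frac{\partial\psi}{\partial u_i}-\frac{\partial\phi}{\partial u_i}\frac{\partial\psi}{\partial\xi_i}\Big).$$ For $\lambda\in\mathbb{C}$ let $\mathcal{B}^\lambda$ be the algebra of smooth linear differential operators (of finite order) on $\lambda$-densities on $\mathbb{R}^n$; trivializing the densities by $|du|^\lambda$, these are the operators $\sum_a f_a(u)\,\partial_u^a$. For $x\in\mathfrak{sl}_{n+1}(\mathbb{R})$ let $\eta^x=\sum_i\eta^x_i\,\partial_{u_i}$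 be the vector field on $\mathbb{R}^n$ given by the infinitesimal projective action of $x$, let $\mu^x=\sum_i\eta^x_i\,\xi_i\in\mathcal{A}^1$ be its principal symbol, and let $\eta^x_\lambda=\eta^x+\lambda\sum_i\partial_{u_i}\eta^x_i\in\mathcal{B}^\lambda$ be its Lie derivative on $\lambda$-densities. There is exactly one linear isomorphism $\mathcal{Q}_\lambda:\mathcal{A}\to\mathcal{B}^\lambda$ such that for every $\phi\in\mathcal{A}^d$ the operator $\mathcal{Q}_\lambda(\phi)$ has order at most $d$ with principal symbol $\phi$ in degree $d$, and such that $\mathcal{Q}_\lambda(\{\mu^x,\phi\})=[\eta^x_\lambda,\mathcal{Q}_\lambda(\phi)]$ for all $x\in\mathfrak{sl}_{n+1}(\mathbb{R})$ and $\phi\in\mathcal{A}$ (the Lecomte–Ovsienko quantization map). Let $\mathcal{Q}_{\lambda,t}:\mathcal{A}[t]\to\mathcal{B}^\lambda[t]$ be the $\mathbb{C}[t]$-linear map with $\mathcal{Q}_{\lambda,t}(\phi)=t^d\mathcal{Q}_\lambda(\phi)$ for $\phi\in\mathcal{A}^d$. For all $\phi,\psi\in\mathcal{A}$ there is exactly one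 element $\phi\star_\lambda\psi=\sum_{p\ge 0}C^\lambda_p(\phi,\psi)\,t^p$ of $\mathcal{A}[t]$ with $\mathcal{Q}_{\lambda,t}(\phi\star_\lambda\psi)=\mathcal{Q}_{\lambda,t}(\phi)\,\mathcal{Q}_{\lambda,t}(\psi)$. Call a map $B:\mathcal{A}\times\mathcal{A}\to\mathcal{A}$ bidifferential on $T^*\mathbb{R}^n$ if every point of $T^*\mathbb{R}^n$ has an open neighbourhood on which $B(\phi,\psi)=\sum_{(\alpha,\beta)}c_{\alpha\beta}\,\partial^\alpha\phi\;\partial^\beta\psi$ for all $\phi,\psi\in\mathcal{A}$, where the sum is finite, $\partial^\alpha,\partial^\beta$ are iterated partial derivatives in the coordinates $(u,\xi)$, and the $c_{\alpha\beta}$ are smooth functions that do not depend on $\phi$ and $\psi$. **Corollary.** For every $\lambda\in\mathbb{C}$ and every integer $p\ge 1$, the operator $C^\lambda_p$ is bidifferential on $T^*\mathbb{R}^n$ if and only if $\lambda=\tfrac12$ and $p=1$. In this exceptional case, $2\,C^{1/2}_1(\phi,\psi)=\{\phi,\psi\}$ for all $\phi,\psi\in\mathcal{A}$. -/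

import Mathlib

open scoped ContDiff

namespace LecomteOvsienko

/-- The algebra `C_∞[u]` of smooth complex-valued functions on `ℝⁿ`. -/
def Smooth (n : ℕ) : Subalgebra ℂ ((Fin n → ℝ) → ℂ) where
  carrier := {f | ContDiff ℝ ∞ f}
  mul_mem' {f g} hf hg := by
    have hf' : ContDiff ℝ ∞ f := hf
    have hg' : ContDiff ℝ ∞ g := hg
    exact hf'.mul hg'
  add_mem' {f g} hf hg := by
    have hf' : ContDiff ℝ ∞ f := hf
    have hg' : ContDiff ℝ ∞ g := hg
    exact hf'.add hg'
  algebraMap_mem' r := by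
    have h : ContDiff ℝ ∞ (fun _ : Fin n → ℝ => r) := contDiff_const
    exact h

theorem Smooth.contDiff {n : ℕ} (f : Smooth n) : ContDiff ℝ ∞ f.1 := f.2

theorem Smooth.differentiable {n : ℕ} (f : Smooth n) : Differentiable ℝ f.1 :=
  (Smooth.contDiff f).differentiable (by simp)

theorem Smooth.contDiff_partial {n : ℕ} (f : Smooth n) (i : Fin n) :
    ContDiff ℝ ∞ (fun u => fderiv ℝ f.1 u (Pi.single i 1)) :=
  ((Smooth.contDiff f).fderiv_right (m := ∞) (by simp)).clm_apply contDiff_const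

/-- The partial derivative `∂/∂u_i` acting on smooth functions on `ℝⁿ`. -/
noncomputable def partialU {n : ℕ} (i : Fin n) : Module.End ℂ (Smooth n) where
  toFun f := ⟨fun u => fderiv ℝ f.1 u (Pi.single i 1), Smooth.contDiff_partial f i⟩
  map_add' f g := by
    apply Subtype.ext
    funext u
    have h := fderiv_add (Smooth.differentiable f u) (Smooth.differentiable g u)
    exact congrArg (fun L => L (Pi.single i 1)) h
  map_smul' c f := by
    apply Subtype.ext
    funext u
    have h := fderiv_const_smul (Smooth.differentiable f u) c
    exact congrArg (fun L => L (Pi.single i 1)) h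

/-- The coordinate function `u_i` on `ℝⁿ`. -/
noncomputable def coord {n : ℕ} (i : Fin n) : Smooth n :=
  ⟨fun u => (u i : ℂ), by
    have h : ContDiff ℝ ∞ (fun u : Fin n → ℝ => (u i : ℂ)) :=
      Complex.ofRealCLM.contDiff.comp (contDiff_apply ℝ ℝ i)
    exact h⟩

/-! ### Symbols -/

/-- `Pol_∞(T*ℝⁿ) = C_∞[u] ⊗ ℂ[ξ]`, the algebra of smooth functions on `T*ℝⁿ` that are polynomial
along the fibres: polynomials in `ξ_1, …, ξ_n` whose coefficients are smooth functions of `u`.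
The piece of degree `d` consists of the homogeneous polynomials of degree `d`. -/
abbrev Pol (n : ℕ) : Type := MvPolynomial (Fin n) (Smooth n)

/-- The symbol `φ` as a function of the Darboux coordinates `(u, ξ)` of `T*ℝⁿ`. -/
noncomputable def Pol.toFunction {n : ℕ} (φ : Pol n) : (Fin n → ℝ) × (Fin n → ℝ) → ℂ :=
  fun z => ∑ a ∈ φ.support, (φ.coeff a).1 z.1 * ∏ i, (z.2 i : ℂ) ^ a i

/-- The derivative `∂/∂u_i` of a symbol (applied to every coefficient). The derivative `∂/∂ξ_i`
is `MvPolynomial.pderiv i`. -/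
noncomputable def Pol.partialU {n : ℕ} (i : Fin n) (φ : Pol n) : Pol n :=
  ∑ a ∈ φ.support, MvPolynomial.monomial a (LecomteOvsienko.partialU i (φ.coeff a))

/-- The Poisson bracket
`{φ, ψ} = ∑ i, (∂φ/∂ξ_i) (∂ψ/∂u_i) - (∂φ/∂u_i) (∂ψ/∂ξ_i)` (so that `{ξ_i, u_i} = 1`). -/
noncomputable def poisson {n : ℕ} (φ ψ : Pol n) : Pol n :=
  ∑ i, (MvPolynomial.pderiv i φ * Pol.partialU i ψ - Pol.partialU i φ * MvPolynomial.pderiv i ψ)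

/-! ### Differential operators

The density bundle of `ℝⁿ` is trivialized by `|du|`, so that differential operators on
`λ`-densities become differential operators on smooth functions; the dependence on `λ` is in the
Lie derivative `lieDensity`. -/

/-- The operator `∂^a = ∂_1^{a_1} ⋯ ∂_n^{a_n}`. -/
noncomputable def partialPow {n : ℕ} (a : Fin n →₀ ℕ) : Module.End ℂ (Smooth n) :=
  (List.ofFn fun i => partialU i ^ a i).prod

/-- The differential operator `∑ f_a ∂^a` with full (normally ordered) symbol `∑ f_a ξ^a`. -/
noncomputable def diffOp {n : ℕ} (φ : Pol n) : Module.End ℂ (Smooth n) :=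
  ∑ a ∈ φ.support, LinearMap.mulLeft ℂ (φ.coeff a) * partialPow a

/-- `P` is a differential operator of order at most `d` whose principal symbol in degree `d` is
`φ`: `P = ∑_{|a| = d} f_a ∂^a + (terms of order < d)` with `φ = ∑_{|a| = d} f_a ξ^a`. -/
def HasPrincipalSymbol {n : ℕ} (d : ℕ) (P : Module.End ℂ (Smooth n)) (φ : Pol n) : Prop :=
  φ.IsHomogeneous d ∧
    ∃ χ : Pol n, (∀ a ∈ χ.support, a.degree < d) ∧ P = diffOp (φ + χ)

/-! ### Vector fields -/

/-- The homogeneous coordinates `(u_0, u_1, …, u_n)`, `u_0 = 1`, on the big cell `ℝⁿ` of `ℝPⁿ`. -/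
noncomputable def homCoord {n : ℕ} : Fin (n + 1) → Smooth n :=
  Fin.cons 1 coord

/-- The components, on the big cell, of the vector field on `ℝPⁿ` generated by a matrix `x`, i.e.
the derivative at `t = 0` of the action of `exp (t x)` on the points `[1, u_1, …, u_n]`. -/
noncomputable def projField {n : ℕ} (x : Matrix (Fin (n + 1)) (Fin (n + 1)) ℝ) (i : Fin n) :
    Smooth n :=
  ∑ l, (x i.succ l : ℂ) • homCoord l - coord i * ∑ l, (x 0 l : ℂ) • homCoord l

/-- The principal symbol `∑ η_i ξ_i` of the vector field `η = ∑ η_i ∂_i`. -/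
noncomputable def momentum {n : ℕ} (η : Fin n → Smooth n) : Pol n :=
  ∑ i, MvPolynomial.C (η i) * MvPolynomial.X i

/-- The Lie derivative `∑ η_i ∂_i + l (∑ ∂_i η_i)` of `η = ∑ η_i ∂_i` on `l`-densities. -/
noncomputable def lieDensity {n : ℕ} (l : ℂ) (η : Fin n → Smooth n) : Module.End ℂ (Smooth n) :=
  ∑ i, LinearMap.mulLeft ℂ (η i) * partialU i
    + l • LinearMap.mulLeft ℂ (∑ i, partialU i (η i))

/-! ### The quantization map and the star product -/

/-- `Q` is an `sl_{n+1}(ℝ)`-equivariant quantization map from `Pol_∞(T*ℝⁿ)` to the differential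
operators on `l`-densities on `ℝⁿ`: a linear isomorphism that preserves principal symbols and
intertwines the actions `{μ^x, ·}` and `[η^x_l, ·]` of `sl_{n+1}(ℝ)`. -/
structure IsEquivariantQuantization (n : ℕ) (l : ℂ)
    (Q : Pol n →ₗ[ℂ] Module.End ℂ (Smooth n)) : Prop where
  injective : Function.Injective Q
  range_eq : Set.range Q = Set.range (diffOp (n := n))
  symbol : ∀ (d : ℕ) (φ : Pol n), φ.IsHomogeneous d → HasPrincipalSymbol d (Q φ) φ
  equivariant : ∀ x : Matrix (Fin (n + 1)) (Fin (n + 1)) ℝ, x.trace = 0 → ∀ φ : Pol n,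
    Q (poisson (momentum (projField x)) φ)
      = lieDensity l (projField x) * Q φ - Q φ * lieDensity l (projField x)

/-- The `ℂ[t]`-linear map `Q_t` from `Pol_∞(T*ℝⁿ)[t]` to polynomials in `t` with differential
operators as coefficients, with `Q_t(φ) = t^d Q(φ)` for `φ` homogeneous of degree `d`. -/
noncomputable def gradedQ {n : ℕ} (Q : Pol n →ₗ[ℂ] Module.End ℂ (Smooth n))
    (Φ : Polynomial (Pol n)) : Polynomial (Module.End ℂ (Smooth n)) :=
  ∑ k ∈ Φ.support, ∑ d ∈ Finset.range ((Φ.coeff k).totalDegree + 1),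
    Polynomial.monomial (k + d) (Q (MvPolynomial.homogeneousComponent d (Φ.coeff k)))

/-- The star product `φ ⋆ ψ = Q_t⁻¹(Q_t(φ) Q_t(ψ))` of two symbols. -/
noncomputable def starProduct {n : ℕ} (Q : Pol n →ₗ[ℂ] Module.End ℂ (Smooth n)) (φ ψ : Pol n) :
    Polynomial (Pol n) :=
  Function.invFun (gradedQ Q) (gradedQ Q (Polynomial.C φ) * gradedQ Q (Polynomial.C ψ))

/-- The coefficient `C_p(φ, ψ)` of `t^p` in `φ ⋆ ψ`. -/
noncomputable def starCoeff {n : ℕ} (Q : Pol n →ₗ[ℂ] Module.End ℂ (Smooth n)) (p : ℕ)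
    (φ ψ : Pol n) : Pol n :=
  (starProduct Q φ ψ).coeff p

/-! ### Bidifferential operators on `T*ℝⁿ` -/

/-- The coordinate directions of `T*ℝⁿ`: `inl i` is `∂/∂u_i`, `inr i` is `∂/∂ξ_i`. -/
def direction {n : ℕ} : Fin n ⊕ Fin n → (Fin n → ℝ) × (Fin n → ℝ)
  | Sum.inl i => (Pi.single i 1, 0)
  | Sum.inr i => (0, Pi.single i 1)

/-- The iterated partial derivative of a function on `T*ℝⁿ` along a list of coordinates. -/
noncomputable def iterPartial {n : ℕ} :
    List (Fin n ⊕ Fin n) → ((Fin n → ℝ) × (Fin n → ℝ) → ℂ) → (Fin n → ℝ) × (Fin n → ℝ) → ℂ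
  | [], F => F
  | s :: α, F => fun z => fderiv ℝ (iterPartial α F) z (direction s)

/-- `B` is (the restriction to `Pol_∞(T*ℝⁿ)` of) a bidifferential operator on `T*ℝⁿ`: locally on
`T*ℝⁿ`, `B(φ, ψ)` is a finite sum of terms `c · ∂^α φ · ∂^β ψ` with smooth coefficients `c`
that depend neither on `φ` nor on `ψ`. -/
def IsBidifferential {n : ℕ} (B : Pol n → Pol n → Pol n) : Prop :=
  ∀ z : (Fin n → ℝ) × (Fin n → ℝ), ∃ U : Set ((Fin n → ℝ) × (Fin n → ℝ)), IsOpen U ∧ z ∈ U ∧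
    ∃ (S : Finset (List (Fin n ⊕ Fin n) × List (Fin n ⊕ Fin n)))
      (c : List (Fin n ⊕ Fin n) × List (Fin n ⊕ Fin n) → (Fin n → ℝ) × (Fin n → ℝ) → ℂ),
      (∀ s ∈ S, ContDiffOn ℝ ∞ (c s) U) ∧
      ∀ φ ψ : Pol n, ∀ y ∈ U, (B φ ψ).toFunction y =
        ∑ s ∈ S, c s y * iterPartial s.1 φ.toFunction y * iterPartial s.2 ψ.toFunction y

end LecomteOvsienko

namespace LecomteOvsienko

variable {n : ℕ}

/-! ### Ring structures

The ring structures are rebuilt on top of the semiring structures in use, so that both unify without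
unfolding the passage from subalgebras to subrings. -/

-- The inverse of the quantization map is explicit in normally ordered symbols. Let D = ∑
-- ∂²/∂u_i∂ξ_i. It commutes with the action of the translations and linear fields on symbols
-- (`divergence_lift_succ`). For the fields generated by the row 0 of the matrix, which include the
-- quadratic ones, the commutator is a multiple of ∂/∂ξ_j on each degree
-- (`divergence_pow_lift_zero`). Passing from symbols to operators on densities changes the action
-- of those same fields by another such multiple (`lieDensity_commutator_diffOp`). Hence a
-- combination ∑ c_k(d) D^k on degree d intertwines the two actions as soon as the c_k satisfy the
-- recursion `dequantCoeff_succ`. This combination is `dequant`. It is unitriangular for the degree,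
-- hence bijective, and normal ordering after its inverse is an equivariant quantization. Uniqueness
-- comes from the Casimir element: it acts on degree d by 2(d² + nd), and these values are distinct,
-- so a unipotent equivariant endomorphism of the symbols is the identity
-- (`eq_one_of_commute_lift`).
--
-- For the negative part, test C_p on u_i^p and ξ_i^d. Both are fixed by `dequant`, and the
-- composition of the operators has normally ordered symbol u_i^p ξ_i^d, so C_p(u_i^p, ξ_i^d) =
-- c_p(d) p! d(d-1)⋯(d-p+1) ξ_i^(d-p) (`IsEquivariantQuantization.starCoeff_coord_pow_X_pow`). At a
-- fixed point with ξ_i = 1, finitely many derivatives of ξ_i^d depend polynomially on d, so a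
-- bidifferential C_p would make this expression a polynomial in d. But c_p(d) is a rational
-- function with denominator ∏ (2d - p - i + n) over i < p. All its zeros must be cancelled by the
-- numerator ∏ (d - 1 - i + λ(n+1)), whose zeros are spaced by 1 while those of the denominator are
-- spaced by 1/2. This leaves p = 1, and then λ = 1/2 (`eq_half_of_polynomial`).
--
-- For λ = 1/2 the coefficient c_1(d) is -1/2 for every d ≥ 1. So `dequant` is 1 - D/2 up to two
-- orders, its inverse is 1 + D/2, and the Leibniz rule for D turns ∑ ∂φ/∂ξ_i ∂ψ/∂u_i, the
-- first-order term of the composition, into half of the Poisson bracket.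

noncomputable scoped instance (priority := 5000) smoothCommRing : CommRing (Smooth n) :=
  let R : CommRing (Smooth n) := Subalgebra.toCommRing _
  { (Subalgebra.toCommSemiring (Smooth n)) with
    neg := R.neg
    sub := R.sub
    sub_eq_add_neg := R.sub_eq_add_neg
    zsmul := R.zsmul
    zsmul_zero' := R.zsmul_zero'
    zsmul_succ' := R.zsmul_succ'
    zsmul_neg' := R.zsmul_neg'
    neg_add_cancel := R.neg_add_cancel
    intCast := R.intCast
    intCast_ofNat := R.intCast_ofNat
    intCast_negSucc := R.intCast_negSucc }

noncomputable scoped instance (priority := 5000) smoothRing : Ring (Smooth n) :=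
  smoothCommRing.toRing

noncomputable scoped instance (priority := 5000) polCommRing : CommRing (Pol n) :=
  let R : CommRing (Pol n) := AddMonoidAlgebra.commRing
  { (AddMonoidAlgebra.commSemiring : CommSemiring (Pol n)) with
    neg := R.neg
    sub := R.sub
    sub_eq_add_neg := R.sub_eq_add_neg
    zsmul := R.zsmul
    zsmul_zero' := R.zsmul_zero'
    zsmul_succ' := R.zsmul_succ'
    zsmul_neg' := R.zsmul_neg'
    neg_add_cancel := R.neg_add_cancel
    intCast := R.intCast
    intCast_ofNat := R.intCast_ofNat
    intCast_negSucc := R.intCast_negSucc }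

noncomputable scoped instance (priority := 5000) polAddCommGroup : AddCommGroup (Pol n) :=
  polCommRing.toRing.toAddCommGroup

noncomputable scoped instance (priority := 5000) polDerivationModule :
    Module (Pol n) (Derivation ℂ (Pol n) (Pol n)) := inferInstance

noncomputable scoped instance (priority := 5000) polDerivationSMul :
    SMul (Pol n) (Derivation ℂ (Pol n) (Pol n)) :=
  Module.toDistribMulAction.toSMul

noncomputable scoped instance (priority := 5000) endRing : Ring (Module.End ℂ (Smooth n)) :=
  let R : Ring (Module.End ℂ (Smooth n)) := Module.End.instRing
  { (Module.End.instSemiring : Semiring (Module.End ℂ (Smooth n))) with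
    neg := R.neg
    sub := R.sub
    sub_eq_add_neg := R.sub_eq_add_neg
    zsmul := R.zsmul
    zsmul_zero' := R.zsmul_zero'
    zsmul_succ' := R.zsmul_succ'
    zsmul_neg' := R.zsmul_neg'
    neg_add_cancel := R.neg_add_cancel
    intCast := R.intCast
    intCast_ofNat := R.intCast_ofNat
    intCast_negSucc := R.intCast_negSucc }

noncomputable scoped instance (priority := 5000) endAddCommGroup :
    AddCommGroup (Module.End ℂ (Smooth n)) :=
  endRing.toAddCommGroup

/-! ### Partial derivatives of smooth functions -/

/-- All sums can be taken over the union of the supports, because an additive `F a` kills the extra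
zero coefficients. This gives the additivity of `diffOp`, which is defined as a sum over the
support. -/
theorem sum_support_add {M : Type*} [AddCommMonoid M] (F : (Fin n →₀ ℕ) → Smooth n →+ M)
    (φ ψ : Pol n) :
    ∑ a ∈ (φ + ψ).support, F a ((φ + ψ).coeff a) =
      ∑ a ∈ φ.support, F a (φ.coeff a) + ∑ a ∈ ψ.support, F a (ψ.coeff a) := by
  classical
  have key : ∀ χ : Pol n, ∀ s : Finset (Fin n →₀ ℕ), χ.support ⊆ s →
      ∑ a ∈ χ.support, F a (χ.coeff a) = ∑ a ∈ s, F a (χ.coeff a) := fun χ s hs =>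
    Finset.sum_subset hs fun a _ ha => by
      rw [MvPolynomial.notMem_support_iff.1 ha, map_zero]
  rw [key _ (φ.support ∪ ψ.support) MvPolynomial.support_add,
    key φ _ Finset.subset_union_left, key ψ _ Finset.subset_union_right,
    ← Finset.sum_add_distrib]
  exact Finset.sum_congr rfl fun a _ => by rw [MvPolynomial.coeff_add, map_add]

theorem sum_support_monomial {M : Type*} [AddCommMonoid M] (F : (Fin n →₀ ℕ) → Smooth n →+ M)
    (a : Fin n →₀ ℕ) (f : Smooth n) :
    ∑ b ∈ (MvPolynomial.monomial a f).support, F b ((MvPolynomial.monomial a f).coeff b) =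
      F a f := by
  classical
  rw [Finset.sum_subset MvPolynomial.support_monomial_subset fun b _ hb => by
    rw [MvPolynomial.notMem_support_iff.1 hb, map_zero]]
  simp

theorem partialU_mul (i : Fin n) (f g : Smooth n) :
    partialU i (f * g) = f * partialU i g + partialU i f * g := by
  apply Subtype.ext
  funext u
  have h := fderiv_mul (Smooth.differentiable f u) (Smooth.differentiable g u)
  have h' := congrArg (fun L => L (Pi.single i 1)) h
  simp only [add_apply, smul_apply, smul_eq_mul] at h'
  change fderiv ℝ (f.1 * g.1) u (Pi.single i 1) = f.1 u * fderiv ℝ g.1 u (Pi.single i 1)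
    + fderiv ℝ f.1 u (Pi.single i 1) * g.1 u
  rw [h', mul_comm (g.1 u)]

theorem partialU_algebraMap (i : Fin n) (c : ℂ) :
    partialU i (algebraMap ℂ (Smooth n) c) = 0 := by
  apply Subtype.ext
  funext u
  have h : fderiv ℝ (fun _ : Fin n → ℝ => c) u = 0 := by simp
  exact congrArg (fun L => L (Pi.single i 1)) h

theorem partialU_one (i : Fin n) : partialU i (1 : Smooth n) = 0 := by
  rw [← map_one (algebraMap ℂ (Smooth n)), partialU_algebraMap]

theorem partialU_coord (i j : Fin n) :
    partialU i (coord j) = if i = j then 1 else 0 := by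
  apply Subtype.ext
  funext u
  have h : HasFDerivAt (fun u : Fin n → ℝ => (u j : ℂ))
      (Complex.ofRealCLM.comp (ContinuousLinearMap.proj j)) u :=
    (Complex.ofRealCLM.comp (ContinuousLinearMap.proj (R := ℝ) (φ := fun _ : Fin n => ℝ) j)).hasFDerivAt
  change fderiv ℝ (fun u : Fin n → ℝ => (u j : ℂ)) u (Pi.single i 1) = _
  rw [h.fderiv]
  by_cases hij : i = j
  · subst hij; simp
  · simp [hij]

theorem partialU_comm (i j : Fin n) (f : Smooth n) :
    partialU i (partialU j f) = partialU j (partialU i f) := by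
  apply Subtype.ext
  funext u
  have hsymm : IsSymmSndFDerivAt ℝ f.1 u :=
    (Smooth.contDiff f).contDiffAt.isSymmSndFDerivAt (by
      rw [minSmoothness_of_isRCLikeNormedField]; exact WithTop.coe_le_coe.2 (le_top (a := (2 : ℕ∞))))
  have hd : DifferentiableAt ℝ (fderiv ℝ f.1) u :=
    (((Smooth.contDiff f).fderiv_right (m := ∞) (by simp)).differentiable (by simp)) u
  have key : ∀ v w : Fin n → ℝ,
      fderiv ℝ (fun x => fderiv ℝ f.1 x v) u w = fderiv ℝ (fderiv ℝ f.1) u w v := by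
    intro v w
    rw [fderiv_clm_apply hd (differentiableAt_const v)]
    simp
  change fderiv ℝ (fun x => fderiv ℝ f.1 x (Pi.single j 1)) u (Pi.single i 1) =
    fderiv ℝ (fun x => fderiv ℝ f.1 x (Pi.single i 1)) u (Pi.single j 1)
  rw [key, key]
  exact hsymm _ _

/-! ### Partial derivatives of symbols -/

theorem coeff_polPartialU (i : Fin n) (φ : Pol n) (a : Fin n →₀ ℕ) :
    (Pol.partialU i φ).coeff a = partialU i (φ.coeff a) := by
  classical
  simp only [Pol.partialU, MvPolynomial.coeff_sum, MvPolynomial.coeff_monomial]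
  rw [Finset.sum_ite_eq']
  split_ifs with h
  · rfl
  · rw [MvPolynomial.notMem_support_iff.1 h, map_zero]

/-- The derivative `∂/∂u_i` of symbols, as a derivation. -/
noncomputable def derU (i : Fin n) : Derivation ℂ (Pol n) (Pol n) :=
  Derivation.mk'
    { toFun := Pol.partialU i
      map_add' := fun φ ψ => by
        ext1 a
        simp only [coeff_polPartialU, MvPolynomial.coeff_add, map_add]
      map_smul' := fun c φ => by
        ext1 a
        simp only [coeff_polPartialU, MvPolynomial.coeff_smul, map_smul, RingHom.id_apply] }
    (fun φ ψ => by
      classical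
      ext1 a
      simp only [LinearMap.coe_mk, AddHom.coe_mk, coeff_polPartialU, smul_eq_mul,
        MvPolynomial.coeff_add, MvPolynomial.coeff_mul, map_sum, partialU_mul,
        Finset.sum_add_distrib, mul_comm ψ])

theorem coeff_derU (i : Fin n) (φ : Pol n) (a : Fin n →₀ ℕ) :
    (derU i φ).coeff a = partialU i (φ.coeff a) := coeff_polPartialU i φ a

theorem derU_C (i : Fin n) (f : Smooth n) :
    derU i (MvPolynomial.C f) = MvPolynomial.C (partialU i f) := by
  classical
  ext1 a
  rw [coeff_derU, MvPolynomial.coeff_C, MvPolynomial.coeff_C]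
  split_ifs <;> simp

theorem derU_X (i j : Fin n) : derU i (MvPolynomial.X j : Pol n) = 0 := by
  classical
  ext1 a
  rw [coeff_derU, MvPolynomial.coeff_X, MvPolynomial.coeff_zero]
  split_ifs
  · exact partialU_one i
  · exact map_zero _

theorem derU_comm (i j : Fin n) (φ : Pol n) : derU i (derU j φ) = derU j (derU i φ) := by
  ext1 a
  simp only [coeff_derU]
  exact partialU_comm i j _

/-- The derivative `∂/∂ξ_i` of symbols, as a derivation over `ℂ`. -/
noncomputable def derXi (i : Fin n) : Derivation ℂ (Pol n) (Pol n) :=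
  (MvPolynomial.pderiv i).restrictScalars ℂ

theorem derXi_apply (i : Fin n) (φ : Pol n) : derXi i φ = MvPolynomial.pderiv i φ := rfl

theorem derXi_C (i : Fin n) (f : Smooth n) : derXi i (MvPolynomial.C f) = 0 := by
  rw [derXi_apply, MvPolynomial.pderiv_C]

theorem derXi_X (i j : Fin n) :
    derXi i (MvPolynomial.X j : Pol n) = if i = j then 1 else 0 := by
  classical
  rw [derXi_apply, MvPolynomial.pderiv_X, Pi.single_apply]
  simp only [eq_comm]

theorem derXi_comm (i j : Fin n) (φ : Pol n) : derXi i (derXi j φ) = derXi j (derXi i φ) := by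
  induction φ using MvPolynomial.induction_on with
  | C f => simp [derXi_C]
  | add φ ψ hφ hψ => simp [hφ, hψ]
  | mul_X φ k h =>
    simp only [Derivation.leibniz, map_add, smul_eq_mul, derXi_X, h]
    split_ifs <;> simp <;> ring

theorem derU_derXi (i j : Fin n) (φ : Pol n) : derU i (derXi j φ) = derXi j (derU i φ) := by
  induction φ using MvPolynomial.induction_on with
  | C f => simp [derXi_C, derU_C]
  | add φ ψ hφ hψ => simp [hφ, hψ]
  | mul_X φ k h =>
    simp only [Derivation.leibniz, map_add, smul_eq_mul, derXi_X, derU_X, h]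
    split_ifs <;> simp [add_comm]

/-! ### Differential operators -/

/-- `partialPow` is an ordered product in a noncommutative ring, so the splitting has to move `g 0`
past the remaining factors of `f`. -/
theorem prod_ofFn_mul_of_commute {M : Type*} [Monoid M] :
    ∀ {m : ℕ} (f g : Fin m → M), (∀ i j, Commute (f i) (g j)) →
      (List.ofFn fun i => f i * g i).prod = (List.ofFn f).prod * (List.ofFn g).prod
  | 0, f, g, _ => by simp
  | m + 1, f, g, h => by
    rw [List.ofFn_succ, List.ofFn_succ, List.ofFn_succ, List.prod_cons, List.prod_cons,
      List.prod_cons, prod_ofFn_mul_of_commute _ _ fun i j => h i.succ j.succ]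
    have hc : Commute (List.ofFn fun i : Fin m => f i.succ).prod (g 0) := by
      apply Commute.list_prod_left
      intro x hx
      obtain ⟨i, rfl⟩ := List.mem_ofFn.1 hx
      exact h _ _
    rw [mul_assoc, mul_assoc, ← mul_assoc (g 0), ← hc.eq, mul_assoc]

theorem prod_ofFn_ite {M : Type*} [Monoid M] :
    ∀ {m : ℕ} (x : M) (j : Fin m), (List.ofFn fun i => if i = j then x else 1).prod = x
  | 0, _, j => j.elim0
  | m + 1, x, j => by
    rw [List.ofFn_succ, List.prod_cons]
    refine Fin.cases ?_ (fun k => ?_) j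
    · have : (fun i : Fin m => if i.succ = 0 then x else 1) = fun _ => (1 : M) := by
        funext i; simp
      rw [this]
      simp
    · simp only [Fin.succ_inj]
      rw [prod_ofFn_ite x k, if_neg (Fin.succ_ne_zero k).symm, one_mul]

theorem partialU_commute (i j : Fin n) : Commute (partialU i) (partialU j) := by
  ext1 f
  exact partialU_comm i j f

theorem partialPow_zero : partialPow (0 : Fin n →₀ ℕ) = 1 := by
  have : (fun i : Fin n => partialU i ^ (0 : Fin n →₀ ℕ) i) = fun _ => 1 := by funext i; simp
  rw [partialPow, this]
  simp

theorem partialPow_add_single (a : Fin n →₀ ℕ) (j : Fin n) :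
    partialPow (a + Finsupp.single j 1) = partialPow a * partialU j := by
  have h : (fun i : Fin n => partialU i ^ (a + Finsupp.single j 1 : Fin n →₀ ℕ) i) =
      fun i => partialU i ^ a i * if i = j then partialU j else 1 := by
    funext i
    by_cases hij : i = j
    · subst hij; simp [pow_succ]
    · simp [hij, Finsupp.single_eq_of_ne hij]
  rw [partialPow, h, prod_ofFn_mul_of_commute, prod_ofFn_ite, partialPow]
  intro i k
  split_ifs
  · exact (partialU_commute i j).pow_left _
  · exact Commute.one_right _

theorem partialPow_commute (a : Fin n →₀ ℕ) (j : Fin n) :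
    Commute (partialPow a) (partialU j) := by
  apply Commute.list_prod_left
  intro x hx
  obtain ⟨i, rfl⟩ := List.mem_ofFn.1 hx
  exact (partialU_commute i j).pow_left _

/-- The operator `f ∂^a`, additively in `f`. -/
noncomputable def diffOpTerm (a : Fin n →₀ ℕ) : Smooth n →+ Module.End ℂ (Smooth n) where
  toFun f := LinearMap.mulLeft ℂ f * partialPow a
  map_zero' := by simp
  map_add' f g := by
    ext1 h
    simp [add_mul]

theorem diffOp_add (φ ψ : Pol n) : diffOp (φ + ψ) = diffOp φ + diffOp ψ :=
  sum_support_add diffOpTerm φ ψ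

theorem diffOp_monomial (a : Fin n →₀ ℕ) (f : Smooth n) :
    diffOp (MvPolynomial.monomial a f) = LinearMap.mulLeft ℂ f * partialPow a :=
  sum_support_monomial diffOpTerm a f

theorem diffOp_C (f : Smooth n) : diffOp (MvPolynomial.C f) = LinearMap.mulLeft ℂ f := by
  rw [MvPolynomial.C_apply, diffOp_monomial, partialPow_zero, mul_one]

theorem diffOp_C_mul (f : Smooth n) (φ : Pol n) :
    diffOp (MvPolynomial.C f * φ) = LinearMap.mulLeft ℂ f * diffOp φ := by
  induction φ using MvPolynomial.induction_on' with
  | monomial a g =>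
    rw [MvPolynomial.C_mul_monomial, diffOp_monomial, diffOp_monomial, ← mul_assoc,
      LinearMap.mulLeft_mul]
    rfl
  | add φ ψ hφ hψ => rw [mul_add, diffOp_add, hφ, hψ, diffOp_add, mul_add]

theorem diffOp_mul_X (φ : Pol n) (i : Fin n) :
    diffOp (φ * MvPolynomial.X i) = diffOp φ * partialU i := by
  induction φ using MvPolynomial.induction_on' with
  | monomial a g =>
    rw [MvPolynomial.X, MvPolynomial.monomial_mul, mul_one, diffOp_monomial, diffOp_monomial,
      partialPow_add_single, mul_assoc]
  | add φ ψ hφ hψ => rw [add_mul, diffOp_add, hφ, hψ, diffOp_add, add_mul]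

theorem partialU_mul_mulLeft (i : Fin n) (f : Smooth n) :
    partialU i * LinearMap.mulLeft ℂ f =
      LinearMap.mulLeft ℂ f * partialU i + LinearMap.mulLeft ℂ (partialU i f) := by
  ext1 g
  exact partialU_mul i f g

/-- The Leibniz rule [∂_i, f] = ∂f/∂u_i, read on full symbols. -/
theorem partialU_mul_diffOp (i : Fin n) (φ : Pol n) :
    partialU i * diffOp φ = diffOp (φ * MvPolynomial.X i + derU i φ) := by
  rw [diffOp_add, diffOp_mul_X]
  induction φ using MvPolynomial.induction_on' with
  | monomial a g =>
    have : derU i (MvPolynomial.monomial a g) = MvPolynomial.monomial a (partialU i g) := by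
      classical
      ext1 b
      rw [coeff_derU, MvPolynomial.coeff_monomial, MvPolynomial.coeff_monomial]
      split_ifs <;> simp
    rw [this, diffOp_monomial, diffOp_monomial, ← mul_assoc, partialU_mul_mulLeft, add_mul,
      mul_assoc, mul_assoc, (partialPow_commute a i).eq]
  | add φ ψ hφ hψ => rw [map_add, diffOp_add, diffOp_add, mul_add, hφ, hψ, add_mul]; abel

/-- Dual to the previous rule: [∂_i, u_j] = δ_ij makes the commutator with u_j act on full symbols
as ∂/∂ξ_j. Coordinates suffice, since the projective fields have polynomial components. -/
theorem diffOp_mul_coord (φ : Pol n) (j : Fin n) :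
    diffOp φ * LinearMap.mulLeft ℂ (coord j) =
      diffOp (MvPolynomial.C (coord j) * φ + derXi j φ) := by
  induction φ using MvPolynomial.induction_on with
  | C f =>
    rw [derXi_C, add_zero, ← map_mul, diffOp_C, diffOp_C, mul_comm, LinearMap.mulLeft_mul]
    rfl
  | add φ ψ hφ hψ => rw [diffOp_add, add_mul, hφ, hψ, ← diffOp_add, map_add]; congr 1; ring
  | mul_X φ i h =>
    rw [diffOp_mul_X, mul_assoc, partialU_mul_mulLeft, partialU_coord, mul_add, ← mul_assoc, h,
      ← diffOp_mul_X, ← diffOp_C, Derivation.leibniz, derXi_X]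
    by_cases hij : i = j
    · subst hij
      simp only [if_true, map_one]
      have : diffOp (1 : Pol n) = 1 := by
        rw [← map_one MvPolynomial.C, diffOp_C]; exact LinearMap.mulLeft_one _ _
      rw [this, mul_one, ← diffOp_add]
      congr 1
      simp only [smul_eq_mul]
      ring
    · have : diffOp (0 : Pol n) = 0 := by simp [diffOp]
      rw [if_neg hij, if_neg (Ne.symm hij), map_zero, this, mul_zero, add_zero]
      congr 1
      simp only [smul_eq_mul]
      ring

/-- `diffOp` as a linear map. -/
noncomputable def diffOpLin : Pol n →ₗ[ℂ] Module.End ℂ (Smooth n) where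
  toFun := diffOp
  map_add' := diffOp_add
  map_smul' c φ := by
    have h : c • φ = MvPolynomial.C (algebraMap ℂ (Smooth n) c) * φ := by
      rw [← MvPolynomial.smul_eq_C_mul, algebraMap_smul]
    rw [h, diffOp_C_mul]
    ext1 g
    simp [Algebra.smul_def]

theorem diffOpLin_apply (φ : Pol n) : diffOpLin φ = diffOp φ := rfl

/-! ### The full symbol is determined by the operator -/

/-- Evaluation of smooth functions at a point. -/
noncomputable def evalAt (u : Fin n → ℝ) : Smooth n →+* ℂ :=
  (Pi.evalRingHom (fun _ => ℂ) u).comp (Smooth n).val.toRingHom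

/-- The linear form `⟨ζ, u⟩` as a real-linear map. -/
noncomputable def linForm (ζ : Fin n → ℂ) : (Fin n → ℝ) →L[ℝ] ℂ :=
  ∑ i, (Complex.ofRealCLM.comp (ContinuousLinearMap.proj i)).smulRight (ζ i)

/-- The exponential `exp ⟨ζ, u⟩`. -/
noncomputable def expForm (ζ : Fin n → ℂ) : Smooth n :=
  ⟨fun u => Complex.exp (linForm ζ u), by
    have h : ContDiff ℝ ∞ (fun u : Fin n → ℝ => Complex.exp (linForm ζ u)) :=
      (linForm ζ).contDiff.cexp
    exact h⟩

theorem partialU_expForm (ζ : Fin n → ℂ) (i : Fin n) :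
    partialU i (expForm ζ) = ζ i • expForm ζ := by
  apply Subtype.ext
  funext u
  have h := ((linForm ζ).hasFDerivAt (x := u)).cexp
  change fderiv ℝ (fun u : Fin n → ℝ => Complex.exp (linForm ζ u)) u (Pi.single i 1) =
    ζ i * Complex.exp (linForm ζ u)
  rw [h.fderiv]
  have : linForm ζ (Pi.single i 1) = ζ i := by
    simp only [linForm, sum_apply, ContinuousLinearMap.smulRight_apply,
      ContinuousLinearMap.comp_apply, ContinuousLinearMap.proj_apply, Pi.single_apply]
    simp [apply_ite Complex.ofReal]
  simp [this, mul_comm]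

/-- An exponential is a joint eigenfunction of the ∂_i, so it evaluates the full symbol at ξ = ζ. -/
theorem diffOp_expForm (φ : Pol n) (ζ : Fin n → ℂ) (u : Fin n → ℝ) :
    (diffOp φ (expForm ζ)).1 u = MvPolynomial.eval₂ (evalAt u) ζ φ * (expForm ζ).1 u := by
  induction φ using MvPolynomial.induction_on with
  | C f => rw [diffOp_C, MvPolynomial.eval₂_C]; rfl
  | add φ ψ hφ hψ => rw [diffOp_add, MvPolynomial.eval₂_add, add_mul, ← hφ, ← hψ]; rfl
  | mul_X φ i h =>
    rw [diffOp_mul_X, MvPolynomial.eval₂_mul, MvPolynomial.eval₂_X, Module.End.mul_apply,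
      partialU_expForm, map_smul, mul_right_comm, ← h, mul_comm]
    rfl

/-- Testing on exponentials, which never vanish, shows that at each u the symbol is a complex
polynomial with no nonzero value. -/
theorem diffOp_injective : Function.Injective (diffOp (n := n)) := by
  change Function.Injective (diffOpLin (n := n))
  rw [injective_iff_map_eq_zero]
  intro φ hφ
  ext1 a
  apply Subtype.ext
  funext u
  have h0 : MvPolynomial.map (evalAt u) φ = 0 := by
    apply MvPolynomial.funext
    intro ζ
    have h := diffOp_expForm φ ζ u
    rw [← diffOpLin_apply, hφ] at h
    have hne : (expForm ζ).1 u ≠ 0 := Complex.exp_ne_zero _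
    rw [MvPolynomial.eval_map, map_zero]
    exact (mul_eq_zero.1 h.symm).resolve_right hne
  have h1 := congrArg (MvPolynomial.coeff a) h0
  rwa [MvPolynomial.coeff_map] at h1

/-! ### The projective action on symbols -/

/-- The Euler operator `∑ ξ_i ∂/∂ξ_i`. -/
noncomputable def euler : Derivation ℂ (Pol n) (Pol n) :=
  ∑ i, (MvPolynomial.X i : Pol n) • derXi i

/-- The homogeneous coordinates as symbols of degree zero. -/
noncomputable def projU (l : Fin (n + 1)) : Pol n := MvPolynomial.C (homCoord l)

/-- The momenta dual to the homogeneous coordinates; `ξ_0 = -∑ u_i ξ_i`. -/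
noncomputable def projXi : Fin (n + 1) → Pol n :=
  Fin.cons (-∑ i, MvPolynomial.C (coord i) * MvPolynomial.X i) MvPolynomial.X

/-- The derivatives along the homogeneous coordinates, with
`∂_0 = -∑ u_i ∂/∂u_i + ∑ ξ_i ∂/∂ξ_i`. -/
noncomputable def projP : Fin (n + 1) → Derivation ℂ (Pol n) (Pol n) :=
  Fin.cons (∑ i, (-MvPolynomial.C (coord i) : Pol n) • derU i + euler) derU

/-- The derivatives along the momenta. -/
noncomputable def projG : Fin (n + 1) → Derivation ℂ (Pol n) (Pol n) := Fin.cons 0 derXi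

/-- The action on symbols of the elementary matrix with entry `1` at `(k, l)`. -/
noncomputable def lift (k l : Fin (n + 1)) : Derivation ℂ (Pol n) (Pol n) :=
  projU l • projP k + (-projXi k) • projG l

theorem derivation_sum_apply {ι : Type*} (s : Finset ι) (D : ι → Derivation ℂ (Pol n) (Pol n))
    (φ : Pol n) : (∑ i ∈ s, D i) φ = ∑ i ∈ s, D i φ := by
  classical
  induction s using Finset.induction_on with
  | empty => simp
  | insert a s ha h => rw [Finset.sum_insert ha, Finset.sum_insert ha, Derivation.add_apply, h]

theorem euler_apply (φ : Pol n) : euler φ = ∑ i, MvPolynomial.X i * derXi i φ := by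
  simp [euler, derivation_sum_apply]

theorem lift_apply (k l : Fin (n + 1)) (φ : Pol n) :
    lift k l φ = projU l * projP k φ - projXi k * projG l φ := by
  rw [sub_eq_add_neg, ← neg_mul]
  rfl

theorem projU_zero : projU (0 : Fin (n + 1)) = 1 := by
  rw [projU, homCoord, Fin.cons_zero, map_one]

theorem projU_succ (i : Fin n) : projU i.succ = MvPolynomial.C (coord i) := rfl

theorem projXi_zero :
    projXi (0 : Fin (n + 1)) = -∑ i, MvPolynomial.C (coord i) * MvPolynomial.X i := rfl

theorem projXi_succ (i : Fin n) : projXi i.succ = MvPolynomial.X i := rfl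

theorem projP_zero_apply (φ : Pol n) :
    projP 0 φ = -∑ i, MvPolynomial.C (coord i) * derU i φ + euler φ := by
  simp [projP, derivation_sum_apply]

theorem projP_succ (i : Fin n) : projP i.succ = derU i := rfl

theorem projG_zero : projG (0 : Fin (n + 1)) = 0 := rfl

theorem projG_succ (i : Fin n) : projG i.succ = derXi i := rfl

theorem derU_coord (i j : Fin n) :
    derU i (MvPolynomial.C (coord j)) = if i = j then 1 else 0 := by
  rw [derU_C, partialU_coord]
  split_ifs <;> simp

theorem euler_C (f : Smooth n) : euler (MvPolynomial.C f : Pol n) = 0 := by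
  simp [euler_apply, derXi_C]

theorem euler_X (i : Fin n) : euler (MvPolynomial.X i : Pol n) = MvPolynomial.X i := by
  simp [euler_apply, derXi_X]

theorem projP_projU_zero_succ (j : Fin n) :
    projP 0 (projU j.succ) = -projU j.succ := by
  simp [projP_zero_apply, projU_succ, derU_coord, euler_C]

theorem projP_projU_zero (k : Fin (n + 1)) : projP k (projU 0) = 0 := by
  rw [projU_zero, Derivation.map_one_eq_zero]

theorem projG_projU (k l : Fin (n + 1)) : projG k (projU l) = 0 := by
  refine Fin.cases ?_ (fun i => ?_) k
  · rfl
  · exact derXi_C _ _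

theorem projP_zero_X (j : Fin n) :
    projP 0 (MvPolynomial.X j : Pol n) = MvPolynomial.X j := by
  simp [projP_zero_apply, derU_X, euler_X]

theorem projP_succ_projXi_zero (i : Fin n) :
    projP i.succ (projXi 0) = -MvPolynomial.X i := by
  simp [projP_succ, projXi_zero, derU_X, derU_coord]

theorem projP_zero_projXi_zero : projP 0 (projXi (0 : Fin (n + 1))) = 0 := by
  simp only [projXi_zero, map_neg, map_sum, Derivation.leibniz, projP_zero_X, ← projU_succ,
    projP_projU_zero_succ, smul_eq_mul]
  exact neg_eq_zero.2 (Finset.sum_eq_zero fun i _ => by ring)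

/-- Extend φ to homogeneous coordinates as φ(U_i/U_0, U_0 Ξ_i). The extension is invariant under (U,
Ξ) ↦ (sU, s⁻¹Ξ), so the Euler operators in U and in Ξ agree on it. This identity and the next ones
are the relations that make the Casimir computation symmetric in the indices 0, …, n. -/
theorem sum_projU_mul_projP (φ : Pol n) : ∑ k, projU k * projP k φ = euler φ := by
  rw [Fin.sum_univ_succ, projU_zero, projP_zero_apply]
  simp only [projU_succ, projP_succ]
  ring

theorem sum_projU_mul_projXi : ∑ k : Fin (n + 1), projU k * projXi k = 0 := by
  rw [Fin.sum_univ_succ, projU_zero, projXi_zero]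
  simp only [projU_succ, projXi_succ]
  ring

theorem sum_projXi_mul_projG (φ : Pol n) : ∑ k, projXi k * projG k φ = euler φ := by
  rw [Fin.sum_univ_succ, projG_zero, euler_apply]
  simp [projG_succ, projXi_succ]

theorem sum_projP_projU : ∑ k : Fin (n + 1), projP k (projU k) = n := by
  rw [Fin.sum_univ_succ, projP_projU_zero]
  simp [projP_succ, projU_succ, derU_coord]

theorem sum_projG_projXi : ∑ k : Fin (n + 1), projG k (projXi k) = n := by
  rw [Fin.sum_univ_succ, projG_zero]
  simp [projG_succ, projXi_succ, derXi_X]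

/-- This is the derivative of the constraint ∑ U_l Ξ_l = 0 along U_k. -/
theorem sum_projU_mul_projP_projXi (k : Fin (n + 1)) :
    ∑ l, projU l * projP k (projXi l) = -projXi k := by
  rw [Fin.sum_univ_succ]
  refine Fin.cases ?_ (fun i => ?_) k
  · rw [projP_zero_projXi_zero, projXi_zero]
    simp only [projXi_succ, projP_zero_X, projU_succ]
    ring
  · rw [projP_succ_projXi_zero, projU_zero]
    simp [projXi_succ, projP_succ, derU_X]

theorem euler_derU (i : Fin n) (φ : Pol n) : euler (derU i φ) = derU i (euler φ) := by
  simp [euler_apply, derU_X, derU_derXi]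

theorem derXi_euler (i : Fin n) (φ : Pol n) :
    derXi i (euler φ) = derXi i φ + euler (derXi i φ) := by
  simp [euler_apply, derXi_X, Finset.sum_add_distrib, derXi_comm i]
  ring

theorem euler_projP (k : Fin (n + 1)) (φ : Pol n) : euler (projP k φ) = projP k (euler φ) := by
  refine Fin.cases ?_ (fun i => euler_derU i φ) k
  simp [projP_zero_apply, euler_C, euler_derU]

theorem projG_euler (k : Fin (n + 1)) (φ : Pol n) :
    projG k (euler φ) = projG k φ + euler (projG k φ) := by
  refine Fin.cases ?_ (fun i => derXi_euler i φ) k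
  simp [projG_zero]

theorem projG_projP_zero (l : Fin (n + 1)) (φ : Pol n) :
    projG l (projP 0 φ) = projP 0 (projG l φ) + projG l φ := by
  refine Fin.cases ?_ (fun i => ?_) l
  · simp [projG_zero]
  · simp [projP_zero_apply, projG_succ, derXi_C, derXi_euler, derU_derXi]
    ring

theorem euler_projXi (k : Fin (n + 1)) : euler (projXi k) = projXi k := by
  refine Fin.cases ?_ (fun i => euler_X i) k
  simp [projXi_zero, euler_C, euler_X]

theorem euler_lift (k l : Fin (n + 1)) (φ : Pol n) :
    euler (lift k l φ) = lift k l (euler φ) := by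
  simp only [lift_apply, map_sub, Derivation.leibniz, euler_projP, projG_euler, euler_projXi,
    smul_eq_mul]
  rw [projU, euler_C]
  ring

/-- The Casimir element acts on symbols through the degree. -/
theorem casimir (φ : Pol n) :
    ∑ k : Fin (n + 1), ∑ l, lift k l (lift l k φ) = 2 * (euler (euler φ) + n * euler φ) := by
  -- Each term is arranged so that a sum over `k` or `l` contracts to one of the Euler or constraint
  -- identities.
  have expand : ∀ k l : Fin (n + 1), lift k l (lift l k φ) =
      projP k (projU k) * (projU l * projP l φ) + projU l * (projU k * projP k (projP l φ))
        - projU l * projP k (projXi l) * projG k φ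
        - projU l * projXi l * projP k (projG k φ)
        - projU k * projXi k * projG l (projP l φ)
        + projXi k * projG k φ * projG l (projXi l)
        + projXi k * (projXi l * projG l (projG k φ)) := by
    intro k l
    simp only [lift_apply, map_sub, Derivation.leibniz, smul_eq_mul, projG_projU]
    ring
  simp only [expand, Finset.sum_add_distrib, Finset.sum_sub_distrib, ← Finset.mul_sum,
    ← Finset.sum_mul, sum_projU_mul_projP, sum_projU_mul_projXi, sum_projP_projU,
    sum_projG_projXi, sum_projU_mul_projP_projXi, sum_projXi_mul_projG]
  rw [Finset.sum_comm]
  simp only [← Finset.mul_sum, sum_projU_mul_projP, euler_projP, neg_mul, Finset.sum_neg_distrib,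
    sum_projXi_mul_projG]
  have h : ∑ k : Fin (n + 1), projXi k * euler (projG k φ) = euler (euler φ) - euler φ := by
    rw [← sum_projXi_mul_projG (euler φ), eq_sub_iff_add_eq,
      ← sum_projXi_mul_projG φ, ← Finset.sum_add_distrib]
    exact Finset.sum_congr rfl fun k _ => by
      rw [sum_projXi_mul_projG, projG_euler]; ring
  rw [h]
  ring

/-! ### The divergence operator -/

/-- The divergence `∑ ∂²/∂u_i∂ξ_i`. -/
noncomputable def divergence : Module.End ℂ (Pol n) :=
  ∑ i, (derU i).toLinearMap * (derXi i).toLinearMap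

theorem divergence_apply (φ : Pol n) : divergence φ = ∑ i, derU i (derXi i φ) := by
  simp [divergence]

theorem divergence_mul (φ ψ : Pol n) :
    divergence (φ * ψ) = φ * divergence ψ + ψ * divergence φ +
      ∑ i, (derU i φ * derXi i ψ + derXi i φ * derU i ψ) := by
  simp only [divergence_apply, Finset.mul_sum, ← Finset.sum_add_distrib]
  refine Finset.sum_congr rfl fun i _ => ?_
  simp only [Derivation.leibniz, map_add, smul_eq_mul]
  ring

theorem sum_derU_projU_mul_derXi (l : Fin (n + 1)) (φ : Pol n) :
    ∑ i, derU i (projU l) * derXi i φ = projG l φ := by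
  refine Fin.cases ?_ (fun j => ?_) l
  · simp [projU_zero, projG_zero]
  · simp [projU_succ, derU_coord, projG_succ]

/-- The coordinate is affine in u and free of ξ, so only the cross terms of the second-order Leibniz
rule remain. -/
theorem divergence_projU_mul (l : Fin (n + 1)) (φ : Pol n) :
    divergence (projU l * φ) = projU l * divergence φ + projG l φ := by
  have h : ∀ i, derXi i (projU l) = 0 := fun i => derXi_C i _
  rw [divergence_mul, divergence_apply (projU l)]
  simp only [h, map_zero, zero_mul, add_zero, Finset.sum_const_zero, mul_zero,
    sum_derU_projU_mul_derXi]

theorem divergence_X_mul (i : Fin n) (φ : Pol n) :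
    divergence (MvPolynomial.X i * φ) = MvPolynomial.X i * divergence φ + derU i φ := by
  rw [divergence_mul, divergence_apply (MvPolynomial.X i)]
  simp only [derXi_X, derU_X]
  simp [apply_ite (derU _)]

theorem divergence_derU (i : Fin n) (φ : Pol n) :
    divergence (derU i φ) = derU i (divergence φ) := by
  simp [divergence_apply, derU_derXi, derU_comm i]

theorem divergence_derXi (i : Fin n) (φ : Pol n) :
    divergence (derXi i φ) = derXi i (divergence φ) := by
  simp [divergence_apply, derU_derXi, derXi_comm i]

theorem divergence_projG (l : Fin (n + 1)) (φ : Pol n) :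
    divergence (projG l φ) = projG l (divergence φ) := by
  refine Fin.cases ?_ (fun i => divergence_derXi i φ) l
  simp [projG_zero]

theorem divergence_euler (φ : Pol n) :
    divergence (euler φ) = euler (divergence φ) + divergence φ := by
  simp only [euler_apply, map_sum, divergence_X_mul, divergence_derXi, Finset.sum_add_distrib]
  rw [divergence_apply φ]

theorem divergence_projP (k : Fin (n + 1)) (φ : Pol n) :
    divergence (projP k φ) = projP k (divergence φ) := by
  refine Fin.cases ?_ (fun i => divergence_derU i φ) k
  simp only [projP_zero_apply, map_add, map_neg, map_sum, ← projU_succ, divergence_projU_mul,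
    divergence_derU, divergence_euler, Finset.sum_add_distrib, projG_succ, ← derU_derXi]
  rw [← divergence_apply φ]
  ring

theorem divergence_projXi_zero_mul (φ : Pol n) :
    divergence (projXi 0 * φ) =
      projXi 0 * divergence φ + projP 0 φ - 2 * euler φ - (n : Pol n) * φ := by
  simp only [projXi_zero, neg_mul, map_neg, Finset.sum_mul, map_sum, mul_assoc, ← projU_succ,
    divergence_projU_mul, divergence_X_mul, projP_zero_apply, projG_succ, Derivation.leibniz,
    derXi_X, if_true, smul_eq_mul, mul_add, Finset.sum_add_distrib, ← euler_apply]
  simp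
  ring

/-- These are the affine fields: the correction ∂/∂u_i ∂/∂Ξ_l from multiplication by U_l cancels the
one from multiplication by ξ_i. -/
theorem divergence_lift_succ (i : Fin n) (l : Fin (n + 1)) (φ : Pol n) :
    divergence (lift i.succ l φ) = lift i.succ l (divergence φ) := by
  rw [lift_apply, lift_apply, map_sub, divergence_projU_mul, divergence_projP, projXi_succ,
    divergence_X_mul, divergence_projG, projP_succ]
  have : projG l (derU i φ) = derU i (projG l φ) := by
    refine Fin.cases ?_ (fun j => (derU_derXi i j φ).symm) l
    simp [projG_zero]
  rw [this]
  ring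

/-- The defect comes from the products with U_l and ξ_0. It involves only ∂/∂Ξ_l and the degree,
which is why powers of the divergence suffice for an equivariant map. -/
theorem divergence_lift_zero (l : Fin (n + 1)) (φ : Pol n) :
    divergence (lift 0 l φ) =
      lift 0 l (divergence φ) + (2 * euler (projG l φ) + (n + 1) * projG l φ) := by
  rw [lift_apply, lift_apply, map_sub, divergence_projU_mul, divergence_projP,
    divergence_projXi_zero_mul, divergence_projG, projG_projP_zero]
  ring

theorem euler_divergence_of_eigen {φ : Pol n} {z : ℂ} (h : euler φ = z • φ) :
    euler (divergence φ) = (z - 1) • divergence φ := by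
  have := divergence_euler φ
  rw [h, map_smul] at this
  have e := sub_smul z 1 (divergence φ)
  rw [e, one_smul, this]
  ring

theorem euler_projG_of_eigen {φ : Pol n} {z : ℂ} (h : euler φ = z • φ) (l : Fin (n + 1)) :
    euler (projG l φ) = (z - 1) • projG l φ := by
  have := projG_euler l φ
  rw [h, Derivation.map_smul] at this
  have e := sub_smul z 1 (projG l φ)
  rw [e, one_smul, this]
  ring

theorem euler_divergence_pow_of_eigen {φ : Pol n} {z : ℂ} (h : euler φ = z • φ) (m : ℕ) :
    euler ((divergence ^ m) φ) = (z - m) • (divergence ^ m) φ := by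
  induction m with
  | zero => simpa using h
  | succ m ih =>
    rw [pow_succ', Module.End.mul_apply, euler_divergence_of_eigen ih]
    push_cast
    rw [sub_sub]

theorem divergence_pow_projG (m : ℕ) (l : Fin (n + 1)) (φ : Pol n) :
    (divergence ^ m) (projG l φ) = projG l ((divergence ^ m) φ) := by
  induction m with
  | zero => rfl
  | succ m ih => rw [pow_succ', Module.End.mul_apply, ih, divergence_projG, Module.End.mul_apply]

theorem divergence_pow_lift_succ (m : ℕ) (i : Fin n) (l : Fin (n + 1)) (φ : Pol n) :
    (divergence ^ m) (lift i.succ l φ) = lift i.succ l ((divergence ^ m) φ) := by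
  induction m with
  | zero => rfl
  | succ m ih =>
    rw [pow_succ', Module.End.mul_apply, ih, divergence_lift_succ, Module.End.mul_apply]

/-- Iterating `divergence_lift_zero`, where the degree drops by one at each step: the factor is the
sum of 2(z - j - 1) + n + 1 over j < m. -/
theorem divergence_pow_lift_zero (m : ℕ) (l : Fin (n + 1)) {φ : Pol n} {z : ℂ}
    (h : euler φ = z • φ) :
    (divergence ^ m) (lift 0 l φ) = lift 0 l ((divergence ^ m) φ) +
      (m * (2 * z - m + n)) • (divergence ^ (m - 1)) (projG l φ) := by
  induction m with
  | zero => simp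
  | succ m ih =>
    have e1 := euler_projG_of_eigen (euler_divergence_pow_of_eigen h m) l
    -- For m = 0 the exponent `m - 1` truncates, but the scalar factor vanishes.
    have e2 : ((m : ℂ) * (2 * z - m + n)) • divergence ((divergence ^ (m - 1)) (projG l φ)) =
        ((m : ℂ) * (2 * z - m + n)) • (divergence ^ m) (projG l φ) := by
      rcases m with _ | m
      · simp
      · rw [Nat.add_sub_cancel, pow_succ', Module.End.mul_apply]
    have e3 : ((n : Pol n) + 1) * projG l ((divergence ^ m) φ) =
        ((n : ℂ) + 1) • projG l ((divergence ^ m) φ) := by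
      rw [Algebra.smul_def]; simp
    have e4 : (2 : Pol n) * ((z - m - 1) • projG l ((divergence ^ m) φ)) =
        (2 * (z - m - 1) : ℂ) • projG l ((divergence ^ m) φ) := by
      rw [mul_smul, two_mul, two_smul]
    rw [pow_succ', Module.End.mul_apply, ih, map_add, map_smul, e2, divergence_lift_zero, e1, e3,
      e4, ← divergence_pow_projG, add_assoc, ← add_smul, ← add_smul, Nat.add_sub_cancel,
      Module.End.mul_apply]
    congr 2
    push_cast
    ring

/-! ### The degree filtration of symbols -/

/-- Symbols all of whose terms have degree less than `m` in `ξ`. -/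
def degLT (n m : ℕ) : Submodule ℂ (Pol n) where
  carrier := {φ | ∀ a : Fin n →₀ ℕ, m ≤ a.degree → φ.coeff a = 0}
  zero_mem' _ _ := MvPolynomial.coeff_zero _
  add_mem' {φ ψ} hφ hψ a ha := by rw [MvPolynomial.coeff_add, hφ a ha, hψ a ha, add_zero]
  smul_mem' c φ hφ a ha := by rw [MvPolynomial.coeff_smul, hφ a ha, smul_zero]

theorem mem_degLT {m : ℕ} {φ : Pol n} :
    φ ∈ degLT n m ↔ ∀ a : Fin n →₀ ℕ, m ≤ a.degree → φ.coeff a = 0 := Iff.rfl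

theorem mem_degLT_iff_support {m : ℕ} {φ : Pol n} :
    φ ∈ degLT n m ↔ ∀ a ∈ φ.support, a.degree < m := by
  simp only [mem_degLT, MvPolynomial.mem_support_iff]
  exact forall_congr' fun a => by rw [← not_lt, not_imp_comm]

theorem degLT_mono {m k : ℕ} (h : m ≤ k) : degLT n m ≤ degLT n k :=
  fun _ hφ a ha => hφ a (h.trans ha)

theorem eq_zero_of_mem_degLT_zero {φ : Pol n} (h : φ ∈ degLT n 0) : φ = 0 := by
  ext1 a
  exact h a (Nat.zero_le _)

theorem mem_degLT_of_isHomogeneous {d : ℕ} {φ : Pol n} (h : φ.IsHomogeneous d) :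
    φ ∈ degLT n (d + 1) := fun _ ha => h.coeff_eq_zero (by omega)

theorem exists_mem_degLT (φ : Pol n) : ∃ m, φ ∈ degLT n m :=
  ⟨φ.totalDegree + 1, mem_degLT_iff_support.2 fun _ ha =>
    Nat.lt_succ_of_le (MvPolynomial.le_totalDegree ha)⟩

theorem mul_mem_degLT {m k : ℕ} {φ ψ : Pol n} (hφ : φ ∈ degLT n m) (hψ : ψ ∈ degLT n k) :
    φ * ψ ∈ degLT n (m + k - 1) := by
  classical
  intro a ha
  rw [MvPolynomial.coeff_mul]
  refine Finset.sum_eq_zero fun x hx => ?_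
  have hd : x.1.degree + x.2.degree = a.degree := by
    rw [← Finset.HasAntidiagonal.mem_antidiagonal.1 hx, map_add]
  by_cases h : m ≤ x.1.degree
  · rw [hφ _ h, zero_mul]
  · rw [hψ _ (by omega), mul_zero]

theorem derU_mem_degLT {m : ℕ} {φ : Pol n} (h : φ ∈ degLT n m) (i : Fin n) :
    derU i φ ∈ degLT n m := fun a ha => by rw [coeff_derU, h a ha, map_zero]

theorem derXi_mem_degLT {m : ℕ} {φ : Pol n} (h : φ ∈ degLT n m) (i : Fin n) :
    derXi i φ ∈ degLT n (m - 1) := fun a ha => by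
  rw [derXi_apply, MvPolynomial.coeff_pderiv, h _ (by rw [map_add, Finsupp.degree_single]; omega),
    zero_mul]

theorem divergence_mem_degLT {m : ℕ} {φ : Pol n} (h : φ ∈ degLT n m) :
    divergence φ ∈ degLT n (m - 1) := by
  rw [divergence_apply]
  exact Submodule.sum_mem _ fun i _ => derU_mem_degLT (derXi_mem_degLT h i) i

theorem divergence_pow_mem_degLT {m : ℕ} {φ : Pol n} (h : φ ∈ degLT n m) (k : ℕ) :
    (divergence ^ k) φ ∈ degLT n (m - k) := by
  induction k with
  | zero => exact h
  | succ k ih =>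
    rw [pow_succ', Module.End.mul_apply, ← Nat.sub_sub]
    exact divergence_mem_degLT ih

/-- The homogeneous component of degree `d`, as a `ℂ`-linear map. -/
noncomputable def homComp (d : ℕ) : Module.End ℂ (Pol n) :=
  (MvPolynomial.homogeneousComponent d).restrictScalars ℂ

theorem homComp_apply (d : ℕ) (φ : Pol n) :
    homComp d φ = MvPolynomial.homogeneousComponent d φ := rfl

theorem homComp_isHomogeneous (d : ℕ) (φ : Pol n) : (homComp d φ).IsHomogeneous d :=
  MvPolynomial.homogeneousComponent_isHomogeneous d φ

theorem coeff_homComp (d : ℕ) (φ : Pol n) (a : Fin n →₀ ℕ) :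
    (homComp d φ).coeff a = if a.degree = d then φ.coeff a else 0 :=
  MvPolynomial.coeff_homogeneousComponent d φ a

theorem homComp_of_isHomogeneous {d : ℕ} {φ : Pol n} (h : φ.IsHomogeneous d) (k : ℕ) :
    homComp k φ = if k = d then φ else 0 := by
  ext1 a
  rw [coeff_homComp]
  split_ifs with h1 h2 h2
  · rfl
  · exact h.coeff_eq_zero (by omega)
  · exact (h.coeff_eq_zero (by omega)).symm
  · rfl

theorem homComp_eq_zero_of_mem_degLT {m k : ℕ} {φ : Pol n} (h : φ ∈ degLT n m) (hk : m ≤ k) :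
    homComp k φ = 0 := by
  ext1 a
  rw [coeff_homComp, MvPolynomial.coeff_zero]
  split_ifs with h1
  · exact h a (by omega)
  · rfl

theorem sum_homComp {m : ℕ} {φ : Pol n} (h : φ ∈ degLT n m) :
    ∑ d ∈ Finset.range m, homComp d φ = φ := by
  ext1 a
  simp only [MvPolynomial.coeff_sum, coeff_homComp, Finset.sum_ite_eq, Finset.mem_range]
  split_ifs with h1
  · rfl
  · exact (h a (by omega)).symm

theorem sub_homComp_mem_degLT {m : ℕ} {φ : Pol n} (h : φ ∈ degLT n (m + 1)) :
    φ - homComp m φ ∈ degLT n m := fun a ha => by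
  rw [MvPolynomial.coeff_sub, coeff_homComp]
  split_ifs with h1
  · exact sub_self _
  · rw [h a (by omega), sub_zero]

theorem linearMap_ext_of_isHomogeneous {M : Type*} [AddCommMonoid M] [Module ℂ M]
    {f g : Pol n →ₗ[ℂ] M} (h : ∀ d φ, MvPolynomial.IsHomogeneous φ d → f φ = g φ) : f = g := by
  refine LinearMap.ext fun φ => ?_
  obtain ⟨m, hm⟩ := exists_mem_degLT φ
  rw [← sum_homComp hm, map_sum, map_sum]
  exact Finset.sum_congr rfl fun d _ => h d _ (homComp_isHomogeneous d φ)

theorem euler_of_isHomogeneous {d : ℕ} {φ : Pol n} (h : φ.IsHomogeneous d) :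
    euler φ = (d : ℂ) • φ := by
  rw [euler_apply, Nat.cast_smul_eq_nsmul]
  exact h.sum_X_mul_pderiv

theorem coeff_euler (φ : Pol n) (a : Fin n →₀ ℕ) :
    (euler φ).coeff a = (a.degree : ℂ) • φ.coeff a := by
  classical
  induction φ using MvPolynomial.induction_on' with
  | monomial b f =>
    rw [euler_of_isHomogeneous (MvPolynomial.isHomogeneous_monomial f rfl),
      MvPolynomial.coeff_smul, MvPolynomial.coeff_monomial]
    split_ifs with h
    · rw [h]
    · rw [smul_zero, smul_zero]
  | add φ ψ hφ hψ => rw [map_add, MvPolynomial.coeff_add, MvPolynomial.coeff_add, hφ, hψ, smul_add]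

/-- The Euler operator has distinct eigenvalues on distinct degrees, so degree statements reduce to
commutation with it. -/
theorem isHomogeneous_of_euler {d : ℕ} {φ : Pol n} (h : euler φ = (d : ℂ) • φ) :
    φ.IsHomogeneous d := by
  intro a ha
  have h1 := congrArg (MvPolynomial.coeff a) h
  rw [coeff_euler, MvPolynomial.coeff_smul, ← sub_eq_zero, ← sub_smul] at h1
  have h2 := (smul_eq_zero.1 h1).resolve_right ha
  have h3 : a.degree = d := by exact_mod_cast sub_eq_zero.1 h2
  rw [← h3, Finsupp.degree_eq_weight_one]
  rfl

theorem lift_isHomogeneous {d : ℕ} {φ : Pol n} (h : φ.IsHomogeneous d) (k l : Fin (n + 1)) :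
    (lift k l φ).IsHomogeneous d := by
  apply isHomogeneous_of_euler
  rw [euler_lift, euler_of_isHomogeneous h, Derivation.map_smul]

theorem projG_isHomogeneous {d : ℕ} {φ : Pol n} (h : φ.IsHomogeneous (d + 1))
    (l : Fin (n + 1)) : (projG l φ).IsHomogeneous d := by
  apply isHomogeneous_of_euler
  rw [euler_projG_of_eigen (euler_of_isHomogeneous h)]
  push_cast
  rw [add_sub_cancel_right]

theorem projG_of_isHomogeneous_zero {φ : Pol n} (h : φ.IsHomogeneous 0) (l : Fin (n + 1)) :
    projG l φ = 0 := by
  refine Fin.cases ?_ (fun i => ?_) l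
  · rfl
  · exact eq_zero_of_mem_degLT_zero (derXi_mem_degLT (mem_degLT_of_isHomogeneous h) i)

/-- A unipotent endomorphism of the symbols that commutes with the projective action is the
identity. -/
theorem eq_one_of_commute_lift {S : Module.End ℂ (Pol n)}
    (hS : ∀ k l φ, S (lift k l φ) = lift k l (S φ))
    (hu : ∀ d φ, MvPolynomial.IsHomogeneous φ d → S φ - φ ∈ degLT n d) : S = 1 := by
  apply linearMap_ext_of_isHomogeneous
  intro d φ hφ
  rw [Module.End.one_apply]
  have e := euler_of_isHomogeneous hφ
  have hh2 : algebraMap ℂ (Pol n) 2 = 2 := map_ofNat _ 2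
  -- The Casimir element commutes with S, so S φ keeps the Casimir eigenvalue of φ.
  have key : (2 * ((d : ℂ) * d + n * d)) • S φ =
      2 * (euler (euler (S φ)) + n * euler (S φ)) := by
    rw [← casimir, ← map_smul]
    simp only [← hS]
    simp only [← map_sum]
    rw [casimir, e, Derivation.map_smul, e]
    congr 1
    simp only [Algebra.smul_def]
    simp only [map_mul, map_add, map_natCast, hh2]
    ring
  ext1 a
  by_cases ha : a.degree < d
  · have h1 := congrArg (MvPolynomial.coeff a) key
    have h2 : (2 : Pol n) * (euler (euler (S φ)) + n * euler (S φ)) =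
        (2 : ℂ) • (euler (euler (S φ)) + (n : ℂ) • euler (S φ)) := by
      simp only [Algebra.smul_def, hh2, map_natCast]
    rw [h2] at h1
    simp only [MvPolynomial.coeff_smul, MvPolynomial.coeff_add, coeff_euler] at h1
    simp only [smul_smul, ← add_smul] at h1
    rw [← sub_eq_zero, ← sub_smul] at h1
    rw [hφ.coeff_eq_zero (by omega)]
    refine (smul_eq_zero.1 h1).resolve_left ?_
    -- The map d ↦ d² + nd is strictly increasing, so S φ has no component of degree below d.
    have hne : (2 * (d * d + n * d) : ℕ) ≠ 2 * (a.degree * a.degree + n * a.degree) := by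
      nlinarith [Nat.zero_le n]
    intro h0
    exact hne (by exact_mod_cast sub_eq_zero.1 h0)
  · have h1 := hu d φ hφ a (by omega)
    rwa [MvPolynomial.coeff_sub, sub_eq_zero] at h1

/-! ### The dequantization map -/

/-- The coefficient of the `k`-th power of the divergence in the inverse of the quantization map,
on symbols of degree `z`. -/
noncomputable def dequantCoeff (n : ℕ) (l : ℂ) (k : ℕ) (z : ℂ) : ℂ :=
  (-1) ^ k / (k.factorial : ℂ) *
    ∏ i ∈ Finset.range k, (z - 1 - i + l * (n + 1)) / (2 * z - k - i + n)

theorem dequantCoeff_zero (l z : ℂ) : dequantCoeff n l 0 z = 1 := by simp [dequantCoeff]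

/-- This is the recursion forced by equivariance under the fields of row 0. The closed product
solves it because replacing z by z - 1 shifts the factors of the numerator and denominator by one
place; the leftover factor is i = 0. -/
theorem dequantCoeff_succ (l : ℂ) (k : ℕ) {z : ℂ} (hz : 2 * z - (k + 1 : ℕ) + n ≠ 0) :
    dequantCoeff n l (k + 1) z * ((k + 1 : ℕ) * (2 * z - (k + 1 : ℕ) + n)) =
      -((z - 1 + l * (n + 1)) * dequantCoeff n l k (z - 1)) := by
  have hp : ∏ i ∈ Finset.range k, (z - 1 - (i + 1 : ℕ) + l * (n + 1)) /
        (2 * z - (k + 1 : ℕ) - (i + 1 : ℕ) + n) =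
      ∏ i ∈ Finset.range k, (z - 1 - 1 - i + l * (n + 1)) / (2 * (z - 1) - k - i + n) := by
    refine Finset.prod_congr rfl fun i _ => ?_
    push_cast
    congr 1 <;> ring
  have hk : ((k + 1 : ℕ) : ℂ) ≠ 0 := Nat.cast_ne_zero.2 k.succ_ne_zero
  have hf : (k.factorial : ℂ) ≠ 0 := Nat.cast_ne_zero.2 k.factorial_ne_zero
  rw [dequantCoeff, dequantCoeff, Finset.prod_range_succ', hp, Nat.factorial_succ]
  generalize ∏ i ∈ Finset.range k,
    (z - 1 - 1 - i + l * (n + 1)) / (2 * (z - 1) - k - i + n) = P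
  simp only [Nat.cast_mul, Nat.cast_zero, sub_zero]
  generalize 2 * z - ((k + 1 : ℕ) : ℂ) + n = w at *
  generalize ((k + 1 : ℕ) : ℂ) = c at *
  field_simp
  ring

/-- The dequantization map on symbols of degree `d`. -/
noncomputable def dequantDeg (l : ℂ) (d : ℕ) : Module.End ℂ (Pol n) :=
  ∑ k ∈ Finset.range (d + 1), dequantCoeff n l k d • (divergence : Module.End ℂ (Pol n)) ^ k

theorem dequantDeg_apply (l : ℂ) (d : ℕ) (φ : Pol n) : dequantDeg l d φ =
    ∑ k ∈ Finset.range (d + 1), dequantCoeff n l k d • (divergence ^ k) φ := by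
  simp [dequantDeg]

/-- Independence of the degree bound is what makes `dequant` additive, since `totalDegree` is not.
-/
theorem sum_dequantDeg_eq (l : ℂ) {φ : Pol n} {m k : ℕ} (hm : φ ∈ degLT n m)
    (hk : φ ∈ degLT n k) :
    ∑ d ∈ Finset.range m, dequantDeg l d (homComp d φ) =
      ∑ d ∈ Finset.range k, dequantDeg l d (homComp d φ) := by
  wlog h : m ≤ k generalizing m k
  · exact (this hk hm (by omega)).symm
  · refine Finset.sum_subset (Finset.range_subset_range.2 h) fun d _ hd => ?_
    rw [homComp_eq_zero_of_mem_degLT hm (by simpa using hd), map_zero]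

/-- The map from normally ordered symbols to projectively equivariant symbols, the inverse of the
quantization map. -/
noncomputable def dequant (l : ℂ) : Module.End ℂ (Pol n) where
  toFun φ := ∑ d ∈ Finset.range (φ.totalDegree + 1), dequantDeg l d (homComp d φ)
  map_add' φ ψ := by
    have h : ∀ χ : Pol n, χ ∈ degLT n (χ.totalDegree + 1) := fun χ =>
      mem_degLT_iff_support.2 fun _ ha => Nat.lt_succ_of_le (MvPolynomial.le_totalDegree ha)
    have h1 := degLT_mono (le_max_left (φ.totalDegree + 1) (ψ.totalDegree + 1)) (h φ)
    have h2 := degLT_mono (le_max_right (φ.totalDegree + 1) (ψ.totalDegree + 1)) (h ψ)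
    rw [sum_dequantDeg_eq l (h _) (Submodule.add_mem _ h1 h2), sum_dequantDeg_eq l (h φ) h1,
      sum_dequantDeg_eq l (h ψ) h2, ← Finset.sum_add_distrib]
    simp only [map_add]
  map_smul' c φ := by
    have h : ∀ χ : Pol n, χ ∈ degLT n (χ.totalDegree + 1) := fun χ =>
      mem_degLT_iff_support.2 fun _ ha => Nat.lt_succ_of_le (MvPolynomial.le_totalDegree ha)
    rw [sum_dequantDeg_eq l (h _) (Submodule.smul_mem _ c (h φ)), RingHom.id_apply,
      Finset.smul_sum]
    simp only [map_smul]

theorem dequant_apply (l : ℂ) {φ : Pol n} {m : ℕ} (h : φ ∈ degLT n m) :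
    dequant l φ = ∑ d ∈ Finset.range m, dequantDeg l d (homComp d φ) :=
  sum_dequantDeg_eq l (mem_degLT_iff_support.2 fun _ ha =>
    Nat.lt_succ_of_le (MvPolynomial.le_totalDegree ha)) h

theorem dequant_of_isHomogeneous (l : ℂ) {φ : Pol n} {d : ℕ} (h : φ.IsHomogeneous d) :
    dequant l φ = ∑ k ∈ Finset.range (d + 1), dequantCoeff n l k d • (divergence ^ k) φ := by
  rw [dequant_apply l (mem_degLT_of_isHomogeneous h), ← dequantDeg_apply,
    Finset.sum_eq_single_of_mem d (by simp)]
  · rw [homComp_of_isHomogeneous h, if_pos rfl]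
  · intro k _ hk
    rw [homComp_of_isHomogeneous h, if_neg hk, map_zero]

/-- The term k = 0 is the identity and every divergence lowers the degree, so `dequant` is
unitriangular. -/
theorem dequant_sub_mem_degLT (l : ℂ) {m : ℕ} {φ : Pol n} (h : φ ∈ degLT n m) :
    dequant l φ - φ ∈ degLT n (m - 1) := by
  induction m generalizing φ with
  | zero =>
    rw [eq_zero_of_mem_degLT_zero h, map_zero, sub_zero]
    exact Submodule.zero_mem _
  | succ m ih =>
    have h1 : dequant l (homComp m φ) - homComp m φ ∈ degLT n m := by
      have hh := homComp_isHomogeneous m φ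
      rw [dequant_of_isHomogeneous l hh, Finset.sum_range_succ', dequantCoeff_zero, pow_zero,
        one_smul, Module.End.one_apply, add_sub_cancel_right]
      refine Submodule.sum_mem _ fun k _ => Submodule.smul_mem _ _ ?_
      exact degLT_mono (by omega)
        (divergence_pow_mem_degLT (mem_degLT_of_isHomogeneous hh) (k + 1))
    have h2 := degLT_mono (by omega : m - 1 ≤ m) (ih (sub_homComp_mem_degLT h))
    have h3 := Submodule.add_mem _ h1 h2
    rw [map_sub] at h3
    have e : dequant l φ - φ = dequant l (homComp m φ) - homComp m φ +
        (dequant l φ - dequant l (homComp m φ) - (φ - homComp m φ)) := by ring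
    rw [e]
    exact h3

theorem dequant_injective (l : ℂ) : Function.Injective (dequant (n := n) l) := by
  rw [injective_iff_map_eq_zero]
  intro φ hφ
  obtain ⟨m, hm⟩ := exists_mem_degLT φ
  induction m with
  | zero => exact eq_zero_of_mem_degLT_zero hm
  | succ m ih =>
    refine ih ?_
    have := dequant_sub_mem_degLT l hm
    rw [hφ, zero_sub] at this
    simpa using Submodule.neg_mem _ this

theorem exists_dequant_eq (l : ℂ) {m : ℕ} {φ : Pol n} (h : φ ∈ degLT n m) :
    ∃ ψ ∈ degLT n m, dequant l ψ = φ := by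
  induction m generalizing φ with
  | zero => exact ⟨φ, h, by rw [eq_zero_of_mem_degLT_zero h, map_zero]⟩
  | succ m ih =>
    -- The error `dequant l φ - φ` has lower degree, so it has a preimage, which is subtracted from
    -- φ.
    obtain ⟨ψ, hψ, e⟩ := ih (dequant_sub_mem_degLT l h)
    refine ⟨φ - ψ, Submodule.sub_mem _ h (degLT_mono m.le_succ hψ), ?_⟩
    rw [map_sub, e, sub_sub_cancel]

theorem dequant_bijective (l : ℂ) : Function.Bijective (dequant (n := n) l) :=
  ⟨dequant_injective l, fun φ => by
    obtain ⟨m, hm⟩ := exists_mem_degLT φ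
    obtain ⟨ψ, -, h⟩ := exists_dequant_eq l hm
    exact ⟨ψ, h⟩⟩

/-- The action of an elementary matrix on normally ordered symbols of operators on densities. -/
noncomputable def liftDensity (l : ℂ) (k j : Fin (n + 1)) (φ : Pol n) : Pol n :=
  lift k j φ + if k = 0 then euler (projG j φ) + (l * (n + 1)) • projG j φ else 0

theorem liftDensity_add (l : ℂ) (k j : Fin (n + 1)) (φ ψ : Pol n) :
    liftDensity l k j (φ + ψ) = liftDensity l k j φ + liftDensity l k j ψ := by
  simp only [liftDensity, map_add, smul_add]
  split_ifs <;> ring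

theorem liftDensity_sum (l : ℂ) (k j : Fin (n + 1)) (s : Finset ℕ) (f : ℕ → Pol n) :
    liftDensity l k j (∑ i ∈ s, f i) = ∑ i ∈ s, liftDensity l k j (f i) := by
  have h0 : liftDensity l k j 0 = (0 : Pol n) := by simp [liftDensity]
  exact map_sum (⟨⟨liftDensity l k j, h0⟩, liftDensity_add l k j⟩ : Pol n →+ Pol n) f s

/-- Two corrections must cancel for row 0: the one from moving powers of the divergence past the
action, and `dequant` of the extra term in `liftDensity`. Both are combinations of D^m ∂φ/∂Ξ_j, and
`dequantCoeff_succ` matches them term by term. -/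
theorem dequant_liftDensity_of_isHomogeneous (l : ℂ) (k j : Fin (n + 1)) {d : ℕ} {φ : Pol n}
    (hφ : φ.IsHomogeneous d) : dequant l (liftDensity l k j φ) = lift k j (dequant l φ) := by
  rw [liftDensity, map_add, dequant_of_isHomogeneous l (lift_isHomogeneous hφ k j),
    dequant_of_isHomogeneous l hφ, map_sum]
  refine Fin.cases ?_ (fun i => ?_) k
  · rw [if_pos rfl]
    have e := euler_of_isHomogeneous hφ
    simp only [divergence_pow_lift_zero _ j e, smul_add, Finset.sum_add_distrib,
      Derivation.map_smul]
    rw [add_assoc, add_eq_left]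
    rcases d with _ | d
    · rw [projG_of_isHomogeneous_zero hφ]
      simp
    · have hG := projG_isHomogeneous hφ j
      rw [euler_of_isHomogeneous hG, ← add_smul, map_smul, dequant_of_isHomogeneous l hG,
        Finset.sum_range_succ', Finset.smul_sum]
      simp only [Nat.cast_zero, zero_mul, zero_smul, smul_zero, add_zero, Nat.add_sub_cancel,
        smul_smul, ← Finset.sum_add_distrib, ← add_smul]
      refine Finset.sum_eq_zero fun m hm => ?_
      have hm' : m < d + 1 := Finset.mem_range.1 hm
      -- The denominator is a positive integer because m ≤ d; this is where no resonance can occur,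
      -- whatever the weight.
      have hz : 2 * ((d + 1 : ℕ) : ℂ) - (m + 1 : ℕ) + n ≠ 0 := by
        have : 2 * ((d + 1 : ℕ) : ℂ) - (m + 1 : ℕ) + n = ((d - m + d + 1 + n : ℕ) : ℂ) := by
          push_cast [Nat.cast_sub (by omega : m ≤ d)]
          ring
        rw [this]
        exact Nat.cast_ne_zero.2 (by omega)
      have hc := dequantCoeff_succ l m hz
      rw [hc]
      have hd : ((d + 1 : ℕ) : ℂ) - 1 = d := by push_cast; ring
      rw [hd, neg_add_cancel, zero_smul]
  · rw [if_neg (Fin.succ_ne_zero i), map_zero, add_zero]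
    simp only [divergence_pow_lift_succ, Derivation.map_smul]

theorem dequant_liftDensity (l : ℂ) (k j : Fin (n + 1)) (φ : Pol n) :
    dequant l (liftDensity l k j φ) = lift k j (dequant l φ) := by
  obtain ⟨m, hm⟩ := exists_mem_degLT φ
  rw [← sum_homComp hm, liftDensity_sum, map_sum, map_sum, map_sum]
  exact Finset.sum_congr rfl fun d _ =>
    dequant_liftDensity_of_isHomogeneous l k j (homComp_isHomogeneous d φ)

/-! ### Equivariance in terms of elementary matrices -/

/-- The vector field generated by the elementary matrix with entry `1` at `(k, j)`. -/
noncomputable def fieldUnit (k j : Fin (n + 1)) : Fin n → Smooth n :=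
  Fin.cases (fun i => -(coord i * homCoord j)) (fun r i => if i = r then homCoord j else 0) k

theorem fieldUnit_zero (j : Fin (n + 1)) (i : Fin n) :
    fieldUnit 0 j i = -(coord i * homCoord j) := rfl

theorem fieldUnit_succ (r : Fin n) (j : Fin (n + 1)) (i : Fin n) :
    fieldUnit r.succ j i = if i = r then homCoord j else 0 := rfl

theorem projField_apply (x : Matrix (Fin (n + 1)) (Fin (n + 1)) ℝ) (i : Fin n) :
    projField x i = ∑ j, (x i.succ j : ℂ) • homCoord j -
      coord i * ∑ j, (x 0 j : ℂ) • homCoord j := rfl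

theorem sum_smul_fieldUnit (y : Fin (n + 1) → Fin (n + 1) → ℂ) (i : Fin n) :
    (∑ k, ∑ j, y k j • fieldUnit k j) i =
      ∑ j, y i.succ j • homCoord j - coord i * ∑ j, y 0 j • homCoord j := by
  rw [Finset.sum_apply]
  simp only [Finset.sum_apply, Pi.smul_apply]
  rw [Fin.sum_univ_succ]
  simp only [fieldUnit_zero, fieldUnit_succ, smul_neg, Finset.sum_neg_distrib, smul_ite,
    smul_zero]
  rw [Finset.sum_eq_single_of_mem i (Finset.mem_univ i)]
  · simp only [if_true, Finset.mul_sum, mul_smul_comm]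
    ring
  · intro r _ hr
    simp [Ne.symm hr]

theorem projField_eq_sum (x : Matrix (Fin (n + 1)) (Fin (n + 1)) ℝ) :
    projField x = ∑ k, ∑ j, (x k j : ℂ) • fieldUnit k j :=
  funext fun i => (sum_smul_fieldUnit (fun k j => (x k j : ℂ)) i).symm

/-- Scalar matrices act trivially on projective space, so the trace condition can be ignored. -/
theorem projField_smul_one (c : ℝ) :
    projField (c • (1 : Matrix (Fin (n + 1)) (Fin (n + 1)) ℝ)) = 0 := by
  funext i
  rw [projField_apply]
  have h : ∀ k : Fin (n + 1), ∑ j, (((c • (1 : Matrix (Fin (n + 1)) (Fin (n + 1)) ℝ)) k j : ℝ) : ℂ) •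
      (homCoord j : Smooth n) = (c : ℂ) • homCoord k := by
    intro k
    rw [Finset.sum_eq_single_of_mem k (Finset.mem_univ k)]
    · simp
    · intro j _ hj
      simp [Matrix.one_apply_ne (Ne.symm hj)]
  rw [h, h]
  simp [homCoord]

theorem projField_add (x y : Matrix (Fin (n + 1)) (Fin (n + 1)) ℝ) :
    projField (x + y) = projField x + projField y := by
  simp only [projField_eq_sum, Matrix.add_apply, Complex.ofReal_add, add_smul,
    Finset.sum_add_distrib]

theorem projField_single (k j : Fin (n + 1)) :
    projField (Matrix.single k j (1 : ℝ)) = fieldUnit (n := n) k j := by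
  rw [projField_eq_sum, Finset.sum_eq_single_of_mem k (Finset.mem_univ k),
    Finset.sum_eq_single_of_mem j (Finset.mem_univ j)]
  · simp
  · intro b _ hb
    simp [Matrix.single_apply_of_col_ne _ _ (Ne.symm hb)]
  · intro b _ hb
    refine Finset.sum_eq_zero fun c _ => ?_
    simp [Matrix.single_apply_of_row_ne (Ne.symm hb)]

/-- The matrix obtained from the elementary matrix with entry `1` at `(k, j)` by subtracting a
multiple of the identity generates the same vector field. -/
theorem exists_trace_eq_zero_projField_eq (k j : Fin (n + 1)) :
    ∃ x : Matrix (Fin (n + 1)) (Fin (n + 1)) ℝ, x.trace = 0 ∧ projField x = fieldUnit k j := by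
  refine ⟨Matrix.single k j 1 + (-((Matrix.single k j (1 : ℝ)).trace / (n + 1))) • 1, ?_, ?_⟩
  · have : ((n : ℝ) + 1) ≠ 0 := by positivity
    rw [Matrix.trace_add, Matrix.trace_smul, Matrix.trace_one]
    simp only [Fintype.card_fin, smul_eq_mul]
    push_cast
    field_simp
    ring
  · rw [projField_add, projField_smul_one, projField_single, add_zero]

/-! ### The Hamiltonian action of the elementary fields on symbols. -/

theorem poisson_eq (φ ψ : Pol n) :
    poisson φ ψ = ∑ i, (derXi i φ * derU i ψ - derU i φ * derXi i ψ) := rfl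

/-- The Hamiltonian action of vector fields on symbols, linear in the field. -/
noncomputable def hamiltonianLin (φ : Pol n) : (Fin n → Smooth n) →ₗ[ℂ] Pol n where
  toFun η := poisson (momentum η) φ
  map_add' η θ := by
    have h : momentum (η + θ) = momentum η + momentum θ := by
      simp [momentum, add_mul, Finset.sum_add_distrib]
    simp only [h, poisson_eq, map_add, add_mul, ← Finset.sum_add_distrib]
    exact Finset.sum_congr rfl fun i _ => by ring
  map_smul' c η := by
    have h : momentum (c • η) = c • momentum η := by
      simp only [momentum, Finset.smul_sum, Pi.smul_apply]
      refine Finset.sum_congr rfl fun i _ => ?_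
      rw [← smul_mul_assoc]
      congr 1
      ext1 a
      classical
      rw [MvPolynomial.coeff_smul, MvPolynomial.coeff_C, MvPolynomial.coeff_C]
      split_ifs <;> simp
    simp only [h, poisson_eq, Derivation.map_smul, RingHom.id_apply, Finset.smul_sum, smul_sub,
      smul_mul_assoc]

/-- The Lie derivative on densities, linear in the field. -/
noncomputable def lieDensityLin (l : ℂ) :
    (Fin n → Smooth n) →ₗ[ℂ] Module.End ℂ (Smooth n) where
  toFun := lieDensity l
  map_add' η θ := by
    ext1 f
    simp [lieDensity, add_mul, Finset.sum_add_distrib]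
    abel
  map_smul' c η := by
    ext1 f
    simp [lieDensity, Finset.smul_sum, Finset.sum_mul]
    congr 1
    exact funext fun i => smul_comm _ _ _

theorem derXi_momentum (η : Fin n → Smooth n) (j : Fin n) :
    derXi j (momentum η) = MvPolynomial.C (η j) := by
  simp [momentum, derXi_C, derXi_X]

theorem derU_momentum (η : Fin n → Smooth n) (j : Fin n) :
    derU j (momentum η) = ∑ i, MvPolynomial.X i * derU j (MvPolynomial.C (η i)) := by
  simp [momentum, derU_X]

theorem poisson_momentum (η : Fin n → Smooth n) (φ : Pol n) :
    poisson (momentum η) φ = ∑ j, MvPolynomial.C (η j) * derU j φ -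
      ∑ j, (∑ i, MvPolynomial.X i * derU j (MvPolynomial.C (η i))) * derXi j φ := by
  simp only [poisson_eq, derXi_momentum, derU_momentum, Finset.sum_sub_distrib]

theorem poisson_momentum_fieldUnit_zero (j : Fin (n + 1)) (φ : Pol n) :
    poisson (momentum (fieldUnit 0 j)) φ = lift 0 j φ := by
  have hC : ∀ i : Fin n, MvPolynomial.C (fieldUnit 0 j i) =
      -(MvPolynomial.C (coord i) * projU j) := fun i => by
    rw [fieldUnit_zero, map_neg, map_mul, projU]
  have hd : ∀ i : Fin n,
      ∑ r, (MvPolynomial.X r : Pol n) * derU i (MvPolynomial.C (fieldUnit 0 j r)) =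
        projXi 0 * derU i (projU j) - projU j * MvPolynomial.X i := by
    intro i
    simp only [hC, map_neg, Derivation.leibniz, derU_coord, smul_eq_mul, projXi_zero]
    have h : ∀ r : Fin n, (MvPolynomial.X r : Pol n) *
        -(MvPolynomial.C (coord r) * derU i (projU j) + projU j * if i = r then 1 else 0) =
        -(MvPolynomial.C (coord r) * MvPolynomial.X r) * derU i (projU j) -
          projU j * if i = r then MvPolynomial.X r else 0 := by
      intro r
      split_ifs <;> ring
    simp only [h, Finset.sum_sub_distrib, ← Finset.mul_sum, ← Finset.sum_mul,
      Finset.sum_neg_distrib, Finset.sum_ite_eq, Finset.mem_univ, if_true]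
  have h1 : ∑ i, -(MvPolynomial.C (coord i) * projU j) * derU i φ =
      -(projU j * ∑ i, MvPolynomial.C (coord i) * derU i φ) := by
    rw [Finset.mul_sum, ← Finset.sum_neg_distrib]
    exact Finset.sum_congr rfl fun i _ => by ring
  have h2 : ∑ i, (projXi 0 * derU i (projU j) - projU j * MvPolynomial.X i) * derXi i φ =
      projXi 0 * projG j φ - projU j * euler φ := by
    rw [← sum_derU_projU_mul_derXi, euler_apply, Finset.mul_sum, Finset.mul_sum,
      ← Finset.sum_sub_distrib]
    exact Finset.sum_congr rfl fun i _ => by ring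
  rw [poisson_momentum, lift_apply, projP_zero_apply]
  simp only [hd]
  simp only [hC]
  rw [h1, h2]
  ring

theorem poisson_momentum_fieldUnit_succ (r : Fin n) (j : Fin (n + 1)) (φ : Pol n) :
    poisson (momentum (fieldUnit r.succ j)) φ = lift r.succ j φ := by
  have hd : ∀ i : Fin n,
      ∑ s, (MvPolynomial.X s : Pol n) * derU i (MvPolynomial.C (fieldUnit r.succ j s)) =
        MvPolynomial.X r * derU i (projU j) := by
    intro i
    rw [Finset.sum_eq_single_of_mem r (Finset.mem_univ r)]
    · rw [fieldUnit_succ, if_pos rfl, projU]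
    · intro s _ hs
      rw [fieldUnit_succ, if_neg hs, map_zero, map_zero, mul_zero]
  rw [poisson_momentum, lift_apply, projP_succ, projXi_succ]
  simp only [hd, mul_assoc]
  rw [← Finset.mul_sum, sum_derU_projU_mul_derXi,
    Finset.sum_eq_single_of_mem r (Finset.mem_univ r)]
  · rw [fieldUnit_succ, if_pos rfl, projU]
  · intro s _ hs
    rw [fieldUnit_succ, if_neg hs, map_zero, zero_mul]

/-- This ties the algebra in homogeneous coordinates to the geometric action. -/
theorem poisson_momentum_fieldUnit (k j : Fin (n + 1)) (φ : Pol n) :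
    poisson (momentum (fieldUnit k j)) φ = lift k j φ :=
  Fin.cases (poisson_momentum_fieldUnit_zero j φ)
    (fun r => poisson_momentum_fieldUnit_succ r j φ) k

/-! ### The action of the elementary fields on differential operators. -/

theorem diffOp_sub (φ ψ : Pol n) : diffOp (φ - ψ) = diffOp φ - diffOp ψ :=
  map_sub diffOpLin φ ψ

theorem diffOp_sum {ι : Type*} (s : Finset ι) (f : ι → Pol n) :
    diffOp (∑ i ∈ s, f i) = ∑ i ∈ s, diffOp (f i) := map_sum diffOpLin f s

theorem diffOp_smul (c : ℂ) (φ : Pol n) : diffOp (c • φ) = c • diffOp φ :=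
  map_smul diffOpLin c φ

theorem diffOp_mul_homCoord (φ : Pol n) (j : Fin (n + 1)) :
    diffOp φ * LinearMap.mulLeft ℂ (homCoord j) = diffOp (projU j * φ + projG j φ) := by
  refine Fin.cases ?_ (fun i => diffOp_mul_coord φ i) j
  rw [projU_zero, projG_zero, Derivation.zero_apply, one_mul, add_zero]
  have : LinearMap.mulLeft ℂ (homCoord (0 : Fin (n + 1))) = 1 := LinearMap.mulLeft_one _ _
  rw [this, mul_one]

theorem mulLeft_commutator_diffOp (φ : Pol n) (j : Fin (n + 1)) :
    LinearMap.mulLeft ℂ (homCoord j) * diffOp φ - diffOp φ * LinearMap.mulLeft ℂ (homCoord j) =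
      -diffOp (projG j φ) := by
  rw [diffOp_mul_homCoord, ← diffOp_C_mul, diffOp_add, projU]
  abel

theorem mulLeft_algebraMap (c : ℂ) :
    LinearMap.mulLeft ℂ (algebraMap ℂ (Smooth n) c) = c • (1 : Module.End ℂ (Smooth n)) := by
  ext1 f
  simp [Algebra.smul_def]

theorem partialU_homCoord (i : Fin n) (j : Fin (n + 1)) :
    partialU i (homCoord j) = algebraMap ℂ (Smooth n) (if j = i.succ then 1 else 0) := by
  refine Fin.cases ?_ (fun r => ?_) j
  · rw [if_neg (Fin.succ_ne_zero i).symm, map_zero]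
    exact partialU_one i
  · change partialU i (coord r) = _
    rw [partialU_coord]
    simp only [Fin.succ_inj, eq_comm]
    split_ifs <;> simp

/-- Affine fields have constant divergence and act on full symbols as on principal ones. For row 0
the field is -U_j times the Euler field: commuting φ past both factors gives the second-order term,
and the divergence -(n+1)U_j, up to a constant, gives the term with the weight. -/
theorem lieDensity_commutator_diffOp (l : ℂ) (k j : Fin (n + 1)) (φ : Pol n) :
    lieDensity l (fieldUnit k j) * diffOp φ - diffOp φ * lieDensity l (fieldUnit k j) =
      diffOp (liftDensity l k j φ) := by
  refine Fin.cases ?_ (fun r => ?_) k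
  · have hfield : ∑ i : Fin n, LinearMap.mulLeft ℂ (fieldUnit 0 j i) * partialU i =
        -(LinearMap.mulLeft ℂ (homCoord j) *
          ∑ i : Fin n, LinearMap.mulLeft ℂ (coord i) * partialU i) := by
      rw [Finset.mul_sum, ← Finset.sum_neg_distrib]
      refine Finset.sum_congr rfl fun i _ => ?_
      have h : LinearMap.mulLeft ℂ (-(coord i * homCoord j)) =
          -(LinearMap.mulLeft ℂ (homCoord j) * LinearMap.mulLeft ℂ (coord i)) :=
        LinearMap.ext fun f => by
          change -(coord i * homCoord j) * f = -(homCoord j * (coord i * f))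
          ring
      rw [fieldUnit_zero, h, neg_mul, mul_assoc]
    -- The constant is 1 for j = 0, where the field is minus the Euler field, and 0 otherwise. It
    -- drops out of the commutator.
    have hdiv : ∃ c : ℂ, ∑ i : Fin n, partialU i (fieldUnit 0 j i) =
        algebraMap ℂ (Smooth n) c - ((n : ℂ) + 1) • homCoord j := by
      simp only [fieldUnit_zero, map_neg, partialU_mul, partialU_coord, if_true, one_mul,
        Finset.sum_neg_distrib, Finset.sum_add_distrib, partialU_homCoord]
      refine Fin.cases ⟨1, ?_⟩ (fun r => ⟨0, ?_⟩) j
      · have : ∀ i : Fin n, (0 : Fin (n + 1)) ≠ i.succ := fun i => (Fin.succ_ne_zero i).symm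
        simp only [if_neg (this _), map_zero, mul_zero, Finset.sum_const_zero, zero_add,
          Algebra.smul_def]
        simp [homCoord]
      · simp only [Fin.succ_inj, Algebra.smul_def]
        simp [homCoord, apply_ite (algebraMap ℂ (Smooth n)), add_mul]
        ring
    obtain ⟨c, hc⟩ := hdiv
    have hE : (∑ i : Fin n, LinearMap.mulLeft ℂ (coord i) * partialU i) * diffOp φ =
        diffOp (∑ i, MvPolynomial.C (coord i) * (φ * MvPolynomial.X i + derU i φ)) := by
      rw [Finset.sum_mul, diffOp_sum]
      exact Finset.sum_congr rfl fun i _ => by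
        rw [mul_assoc, partialU_mul_diffOp, diffOp_C_mul]
    have hE' : ∀ ψ : Pol n, diffOp ψ * (∑ i : Fin n, LinearMap.mulLeft ℂ (coord i) * partialU i) =
        diffOp (∑ i, (MvPolynomial.C (coord i) * ψ + derXi i ψ) * MvPolynomial.X i) := by
      intro ψ
      rw [Finset.mul_sum, diffOp_sum]
      exact Finset.sum_congr rfl fun i _ => by
        rw [← mul_assoc, diffOp_mul_coord, diffOp_mul_X]
    have hmul : LinearMap.mulLeft ℂ (algebraMap ℂ (Smooth n) c - ((n : ℂ) + 1) • homCoord j) =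
        c • (1 : Module.End ℂ (Smooth n)) - ((n : ℂ) + 1) • LinearMap.mulLeft ℂ (homCoord j) := by
      rw [← mulLeft_algebraMap]
      ext1 f
      simp [sub_mul]
    have hcomm := mulLeft_commutator_diffOp φ j
    have hsplit : lieDensity l (fieldUnit 0 j) * diffOp φ - diffOp φ * lieDensity l (fieldUnit 0 j) =
        diffOp φ * LinearMap.mulLeft ℂ (homCoord j) *
            (∑ i : Fin n, LinearMap.mulLeft ℂ (coord i) * partialU i) -
          LinearMap.mulLeft ℂ (homCoord j) *
            ((∑ i : Fin n, LinearMap.mulLeft ℂ (coord i) * partialU i) * diffOp φ) -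
          (l * (n + 1)) • (LinearMap.mulLeft ℂ (homCoord j) * diffOp φ -
            diffOp φ * LinearMap.mulLeft ℂ (homCoord j)) := by
      rw [lieDensity, hfield, hc, hmul]
      simp only [add_mul, mul_add, neg_mul, mul_neg, smul_mul_assoc, mul_smul_comm, sub_mul,
        mul_sub, one_mul, mul_one, smul_sub, smul_smul, mul_assoc]
      abel
    rw [hsplit, hcomm, hE, diffOp_mul_homCoord, hE', ← diffOp_C_mul, ← diffOp_sub, smul_neg,
      sub_neg_eq_add, ← diffOp_smul, ← diffOp_add, liftDensity, if_pos rfl, ← add_assoc]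
    congr 2
    have e1 : ∑ i, (MvPolynomial.C (coord i) * (projU j * φ + projG j φ) +
        derXi i (projU j * φ + projG j φ)) * MvPolynomial.X i =
        (∑ i, MvPolynomial.C (coord i) * MvPolynomial.X i) * (projU j * φ + projG j φ) +
          euler (projU j * φ + projG j φ) := by
      rw [euler_apply, Finset.sum_mul, ← Finset.sum_add_distrib]
      exact Finset.sum_congr rfl fun i _ => by ring
    have e2 : ∑ i, MvPolynomial.C (coord i) * (φ * MvPolynomial.X i + derU i φ) =
        (∑ i, MvPolynomial.C (coord i) * MvPolynomial.X i) * φ +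
          ∑ i, MvPolynomial.C (coord i) * derU i φ := by
      rw [Finset.sum_mul, ← Finset.sum_add_distrib]
      exact Finset.sum_congr rfl fun i _ => by ring
    have e3 : euler (projU j : Pol n) = 0 := euler_C _
    rw [e1, e2, lift_apply, projP_zero_apply, projXi_zero, map_add, Derivation.leibniz, e3]
    simp only [projU, smul_eq_mul]
    ring
  · have hfield : ∑ i : Fin n, LinearMap.mulLeft ℂ (fieldUnit r.succ j i) * partialU i =
        LinearMap.mulLeft ℂ (homCoord j) * partialU r := by
      rw [Finset.sum_eq_single_of_mem r (Finset.mem_univ r)]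
      · rw [fieldUnit_succ, if_pos rfl]
      · intro s _ hs
        simp [fieldUnit_succ, hs]
    have hdiv : ∑ i : Fin n, partialU i (fieldUnit r.succ j i) =
        algebraMap ℂ (Smooth n) (if j = r.succ then 1 else 0) := by
      rw [Finset.sum_eq_single_of_mem r (Finset.mem_univ r)]
      · rw [fieldUnit_succ, if_pos rfl, partialU_homCoord]
      · intro s _ hs
        simp [fieldUnit_succ, hs]
    rw [lieDensity, hfield, hdiv, mulLeft_algebraMap, add_mul, mul_add, add_sub_add_comm,
      ← mul_assoc (diffOp φ), diffOp_mul_homCoord, ← diffOp_mul_X, mul_assoc,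
      partialU_mul_diffOp, ← diffOp_C_mul, ← diffOp_sub]
    have : (l • (if j = r.succ then (1 : ℂ) else 0) • (1 : Module.End ℂ (Smooth n))) * diffOp φ -
        diffOp φ * (l • (if j = r.succ then (1 : ℂ) else 0) • (1 : Module.End ℂ (Smooth n))) =
        0 := by
      simp only [smul_mul_assoc, mul_smul_comm, one_mul, mul_one, sub_self]
    rw [this, add_zero, liftDensity, if_neg (Fin.succ_ne_zero r), add_zero, lift_apply,
      projP_succ, projXi_succ]
    congr 1
    simp only [projU]
    ring

/-! ### Existence and uniqueness of the quantization map -/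

theorem IsEquivariantQuantization.apply_lift {l : ℂ} {Q : Pol n →ₗ[ℂ] Module.End ℂ (Smooth n)}
    (hQ : IsEquivariantQuantization n l Q) (k j : Fin (n + 1)) (φ : Pol n) :
    Q (lift k j φ) = lieDensity l (fieldUnit k j) * Q φ - Q φ * lieDensity l (fieldUnit k j) := by
  obtain ⟨x, hx, e⟩ := exists_trace_eq_zero_projField_eq (n := n) k j
  have h := hQ.equivariant x hx φ
  rw [e, poisson_momentum_fieldUnit] at h
  exact h

theorem equivariant_of_apply_lift {l : ℂ} {Q : Pol n →ₗ[ℂ] Module.End ℂ (Smooth n)}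
    (hQ : ∀ k j φ, Q (lift k j φ) =
      lieDensity l (fieldUnit k j) * Q φ - Q φ * lieDensity l (fieldUnit k j))
    (x : Matrix (Fin (n + 1)) (Fin (n + 1)) ℝ) (φ : Pol n) :
    Q (poisson (momentum (projField x)) φ) =
      lieDensity l (projField x) * Q φ - Q φ * lieDensity l (projField x) := by
  have h1 : poisson (momentum (projField x)) φ = ∑ k, ∑ j, (x k j : ℂ) • lift k j φ := by
    change hamiltonianLin φ (projField x) = _
    rw [projField_eq_sum]
    simp only [map_sum, map_smul]
    exact Finset.sum_congr rfl fun k _ => Finset.sum_congr rfl fun j _ => by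
      rw [← poisson_momentum_fieldUnit]; rfl
  have h2 : lieDensity l (projField x) =
      ∑ k, ∑ j, (x k j : ℂ) • lieDensity l (fieldUnit k j) := by
    change lieDensityLin l (projField x) = _
    rw [projField_eq_sum]
    simp only [map_sum, map_smul]
    rfl
  rw [h1, h2]
  simp only [map_sum, map_smul, hQ, Finset.sum_mul, Finset.mul_sum, ← Finset.sum_sub_distrib,
    smul_mul_assoc, mul_smul_comm, smul_sub]

/-- Uniqueness. Let s send a symbol to the full symbol of its quantization. Then `dequant l * s`
commutes with the projective action and is unipotent, so the Casimir argument makes it the identity.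
-/
theorem IsEquivariantQuantization.apply_dequant {l : ℂ}
    {Q : Pol n →ₗ[ℂ] Module.End ℂ (Smooth n)} (hQ : IsEquivariantQuantization n l Q)
    (ψ : Pol n) : Q (dequant l ψ) = diffOp ψ := by
  have hinj : Function.Injective (diffOpLin (n := n)) := diffOp_injective
  have hmem : ∀ φ, Q φ ∈ LinearMap.range (diffOpLin (n := n)) := fun φ => by
    have h : Q φ ∈ Set.range (diffOp (n := n)) := hQ.range_eq ▸ Set.mem_range_self φ
    exact h
  let s : Module.End ℂ (Pol n) :=
    (LinearEquiv.ofInjective diffOpLin hinj).symm.toLinearMap ∘ₗ Q.codRestrict _ hmem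
  have hs : ∀ φ, diffOp (s φ) = Q φ := fun φ => by
    have h := (LinearEquiv.ofInjective diffOpLin hinj).apply_symm_apply (Q.codRestrict _ hmem φ)
    exact congrArg Subtype.val h
  have hone : dequant l * s = 1 := by
    apply eq_one_of_commute_lift
    · intro k j φ
      rw [Module.End.mul_apply, Module.End.mul_apply, ← dequant_liftDensity]
      congr 1
      apply diffOp_injective
      rw [hs, hQ.apply_lift, ← hs φ, lieDensity_commutator_diffOp]
    · intro d φ hφ
      obtain ⟨-, χ, hχ, e⟩ := hQ.symbol d φ hφ
      rw [← hs φ] at e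
      have e' := diffOp_injective e
      have hχ' : χ ∈ degLT n d := mem_degLT_iff_support.2 hχ
      have hmem' : s φ ∈ degLT n (d + 1) := by
        rw [e']
        exact Submodule.add_mem _ (mem_degLT_of_isHomogeneous hφ) (degLT_mono d.le_succ hχ')
      have h := Submodule.add_mem _ (dequant_sub_mem_degLT l hmem') hχ'
      have e3 : (dequant l * s : Module.End ℂ (Pol n)) φ - φ = dequant l (s φ) - s φ + χ := by
        rw [Module.End.mul_apply]
        nth_rewrite 3 [e']
        ring
      rw [e3]
      exact h
  have h1 : s (dequant l ψ) = ψ := by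
    apply dequant_injective l
    exact LinearMap.congr_fun hone (dequant l ψ)
  rw [← hs, h1]

/-- The projectively equivariant quantization map. -/
noncomputable def quantization (n : ℕ) (l : ℂ) : Pol n →ₗ[ℂ] Module.End ℂ (Smooth n) :=
  diffOpLin ∘ₗ (LinearEquiv.ofBijective (dequant l) (dequant_bijective l)).symm.toLinearMap

theorem quantization_dequant (l : ℂ) (ψ : Pol n) :
    quantization n l (dequant l ψ) = diffOp ψ := by
  have h := (LinearEquiv.ofBijective (dequant (n := n) l) (dequant_bijective l)).symm_apply_apply ψ
  exact congrArg diffOp h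

theorem quantization_isEquivariantQuantization (l : ℂ) :
    IsEquivariantQuantization n l (quantization n l) where
  injective := diffOp_injective.comp (LinearEquiv.injective _)
  range_eq := by
    ext P
    constructor
    · rintro ⟨φ, rfl⟩
      exact ⟨_, rfl⟩
    · rintro ⟨ψ, rfl⟩
      exact ⟨dequant l ψ, quantization_dequant l ψ⟩
  symbol d φ hφ := by
    obtain ⟨ψ, hψ, rfl⟩ := exists_dequant_eq l (mem_degLT_of_isHomogeneous hφ)
    refine ⟨hφ, ψ - dequant l ψ, ?_, ?_⟩
    · apply mem_degLT_iff_support.1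
      have h := Submodule.neg_mem _ (dequant_sub_mem_degLT l hψ)
      rwa [neg_sub] at h
    · rw [quantization_dequant, add_sub_cancel]
  equivariant x _ φ := by
    refine equivariant_of_apply_lift (fun k j χ => ?_) x φ
    obtain ⟨ψ, rfl⟩ := (dequant_bijective l).2 χ
    rw [← dequant_liftDensity, quantization_dequant, quantization_dequant,
      lieDensity_commutator_diffOp]

theorem IsEquivariantQuantization.eq_quantization {l : ℂ}
    {Q : Pol n →ₗ[ℂ] Module.End ℂ (Smooth n)} (hQ : IsEquivariantQuantization n l Q) :
    Q = quantization n l := by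
  refine LinearMap.ext fun φ => ?_
  obtain ⟨ψ, rfl⟩ := (dequant_bijective l).2 φ
  rw [hQ.apply_dequant, quantization_dequant]

/-! ### Composition of differential operators -/

/-- Left composition with the operator `φ` of order at most `a` is known to first order. -/
def HasFirstOrderComp (a : ℕ) (φ : Pol n) : Prop :=
  ∀ (b : ℕ) (ψ : Pol n), ψ ∈ degLT n (b + 1) → ∃ r ∈ degLT n (a + b - 1),
    diffOp φ * diffOp ψ = diffOp (φ * ψ + ∑ i, derXi i φ * derU i ψ + r)

theorem HasFirstOrderComp.mono {a a' : ℕ} (h : a ≤ a') {φ : Pol n} (hφ : HasFirstOrderComp a φ) :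
    HasFirstOrderComp a' φ := fun b ψ hψ => by
  obtain ⟨r, hr, e⟩ := hφ b ψ hψ
  exact ⟨r, degLT_mono (by omega) hr, e⟩

theorem HasFirstOrderComp.add {a : ℕ} {φ φ' : Pol n} (hφ : HasFirstOrderComp a φ)
    (hφ' : HasFirstOrderComp a φ') : HasFirstOrderComp a (φ + φ') := fun b ψ hψ => by
  obtain ⟨r, hr, e⟩ := hφ b ψ hψ
  obtain ⟨r', hr', e'⟩ := hφ' b ψ hψ
  refine ⟨r + r', Submodule.add_mem _ hr hr', ?_⟩
  rw [diffOp_add, add_mul, e, e', ← diffOp_add]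
  congr 1
  simp only [map_add, add_mul, Finset.sum_add_distrib]
  ring

theorem hasFirstOrderComp_C (f : Smooth n) : HasFirstOrderComp 0 (MvPolynomial.C f) :=
  fun b ψ _ => ⟨0, Submodule.zero_mem _, by simp [derXi_C, diffOp_C, diffOp_C_mul]⟩

/-- Moving ∂_j past ψ produces the symbols ψ ξ_j and ∂ψ/∂u_j, to which the hypothesis on φ applies;
what is differentiated twice goes into the remainder. -/
theorem HasFirstOrderComp.mul_X {a : ℕ} {φ : Pol n} (hφ : HasFirstOrderComp a φ)
    (hmem : φ ∈ degLT n (a + 1)) (j : Fin n) :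
    HasFirstOrderComp (a + 1) (φ * MvPolynomial.X j) := fun b ψ hψ => by
  have hX : (MvPolynomial.X j : Pol n) ∈ degLT n 2 :=
    mem_degLT_of_isHomogeneous (MvPolynomial.isHomogeneous_X _ j)
  obtain ⟨r, hr, e⟩ := hφ (b + 1) (ψ * MvPolynomial.X j)
    (degLT_mono (by omega) (mul_mem_degLT hψ hX))
  obtain ⟨r', hr', e'⟩ := hφ b (derU j ψ) (derU_mem_degLT hψ j)
  refine ⟨r + r' + ∑ i, derXi i φ * derU i (derU j ψ), ?_, ?_⟩
  · refine Submodule.add_mem _ (Submodule.add_mem _ (degLT_mono (by omega) hr)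
      (degLT_mono (by omega) hr')) (Submodule.sum_mem _ fun i _ => ?_)
    exact degLT_mono (by omega)
      (mul_mem_degLT (derXi_mem_degLT hmem i) (derU_mem_degLT (derU_mem_degLT hψ j) i))
  · rw [diffOp_mul_X, mul_assoc, partialU_mul_diffOp, diffOp_add (ψ * MvPolynomial.X j), mul_add,
      e, e', ← diffOp_add]
    congr 1
    have h1 : ∑ i, derXi i φ * derU i (ψ * MvPolynomial.X j) =
        MvPolynomial.X j * ∑ i, derXi i φ * derU i ψ := by
      rw [Finset.mul_sum]
      refine Finset.sum_congr rfl fun i _ => ?_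
      rw [Derivation.leibniz, derU_X]
      simp only [smul_eq_mul]
      ring
    have h2 : ∑ i, derXi i (φ * MvPolynomial.X j) * derU i ψ =
        φ * derU j ψ + MvPolynomial.X j * ∑ i, derXi i φ * derU i ψ := by
      simp only [Derivation.leibniz, derXi_X, smul_eq_mul, add_mul, Finset.sum_add_distrib,
        Finset.mul_sum, mul_assoc, ite_mul, one_mul, zero_mul, mul_ite, mul_zero]
      simp
    rw [h1, h2]
    ring

theorem hasFirstOrderComp_monomial (c : Fin n →₀ ℕ) (f : Smooth n) :
    HasFirstOrderComp c.degree (MvPolynomial.monomial c f) := by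
  generalize hd : c.degree = d
  induction d generalizing c with
  | zero =>
    have hc : c = 0 := (Finsupp.degree_eq_zero_iff c).1 hd
    rw [hc]
    exact hasFirstOrderComp_C f
  | succ d ih =>
    obtain ⟨j, hj⟩ : ∃ j, c j ≠ 0 := by
      by_contra! h
      have hc : c = 0 := Finsupp.ext h
      rw [hc, map_zero] at hd
      omega
    have hc := Finsupp.sub_add_single_one_cancel hj
    have hdeg : (c - Finsupp.single j 1).degree = d := by
      have h := congrArg Finsupp.degree hc
      rw [map_add, Finsupp.degree_single] at h
      omega
    have h := (ih _ hdeg).mul_X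
      (mem_degLT_of_isHomogeneous (MvPolynomial.isHomogeneous_monomial f hdeg)) j
    rwa [MvPolynomial.X, MvPolynomial.monomial_mul, mul_one, hc] at h

/-- The composition of differential operators to first order. -/
theorem hasFirstOrderComp_of_mem_degLT {a : ℕ} {φ : Pol n} (h : φ ∈ degLT n (a + 1)) :
    HasFirstOrderComp a φ := by
  rw [MvPolynomial.as_sum φ]
  refine Finset.sum_induction _ _ (fun _ _ => HasFirstOrderComp.add) ?_ fun c hc => ?_
  · simpa using (hasFirstOrderComp_C (n := n) 0).mono (Nat.zero_le a)
  · exact (hasFirstOrderComp_monomial c _).mono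
      (Nat.le_of_lt_succ (mem_degLT_iff_support.1 h c hc))

/-! ### The star product -/

theorem homComp_homComp (d e : ℕ) (φ : Pol n) :
    homComp d (homComp e φ) = if d = e then homComp e φ else 0 :=
  homComp_of_isHomogeneous (homComp_isHomogeneous e φ) d

theorem coeff_gradedQ_summand (Q : Pol n →ₗ[ℂ] Module.End ℂ (Smooth n)) (k N : ℕ) (χ : Pol n) :
    (∑ d ∈ Finset.range (χ.totalDegree + 1), Polynomial.monomial (k + d)
      (Q (MvPolynomial.homogeneousComponent d χ))).coeff N =
      if k ≤ N then Q (homComp (N - k) χ) else 0 := by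
  simp only [Polynomial.finsetSum_coeff, Polynomial.coeff_monomial]
  split_ifs with hk
  · have h : ∀ d, (if k + d = N then Q (MvPolynomial.homogeneousComponent d χ) else 0) =
        if d = N - k then Q (homComp (N - k) χ) else 0 := by
      intro d
      by_cases hd : d = N - k
      · rw [if_pos (by omega), if_pos hd, ← hd, homComp_apply]
      · rw [if_neg (by omega), if_neg hd]
    rw [Finset.sum_congr rfl fun d _ => h d, Finset.sum_ite_eq']
    simp only [Finset.mem_range]
    split_ifs with h1
    · rfl
    · rw [homComp_eq_zero_of_mem_degLT (m := χ.totalDegree + 1) _ (by omega), map_zero]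
      exact mem_degLT_iff_support.2 fun _ ha =>
        Nat.lt_succ_of_le (MvPolynomial.le_totalDegree ha)
  · exact Finset.sum_eq_zero fun d _ => if_neg (by omega)

/-- The power of t after quantization is the power before it plus the degree in ξ. -/
theorem coeff_gradedQ (Q : Pol n →ₗ[ℂ] Module.End ℂ (Smooth n)) (Φ : Polynomial (Pol n)) (N : ℕ) :
    (gradedQ Q Φ).coeff N =
      Q (∑ x ∈ Finset.HasAntidiagonal.antidiagonal N, homComp x.2 (Φ.coeff x.1)) := by
  rw [gradedQ, Polynomial.finsetSum_coeff, Finset.sum_congr rfl fun k _ =>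
    coeff_gradedQ_summand Q k N (Φ.coeff k), map_sum,
    Finset.Nat.sum_antidiagonal_eq_sum_range_succ (fun i j => Q (homComp j (Φ.coeff i))),
    ← Finset.sum_filter]
  refine Finset.sum_subset (fun k hk => ?_) fun k hk hk' => ?_
  · have := (Finset.mem_filter.1 hk).2
    exact Finset.mem_range.2 (by omega)
  · have h : k ∉ Φ.support := fun h => hk' (Finset.mem_filter.2
      ⟨h, by have := Finset.mem_range.1 hk; omega⟩)
    rw [Polynomial.notMem_support_iff.1 h, map_zero, map_zero]

theorem gradedQ_add (Q : Pol n →ₗ[ℂ] Module.End ℂ (Smooth n)) (Φ Ψ : Polynomial (Pol n)) :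
    gradedQ Q (Φ + Ψ) = gradedQ Q Φ + gradedQ Q Ψ := by
  ext1 N
  simp only [Polynomial.coeff_add, coeff_gradedQ, map_add, Finset.sum_add_distrib]

theorem gradedQ_zero (Q : Pol n →ₗ[ℂ] Module.End ℂ (Smooth n)) :
    gradedQ Q (0 : Polynomial (Pol n)) = 0 := by
  simp [gradedQ]

theorem gradedQ_sum {ι : Type*} (Q : Pol n →ₗ[ℂ] Module.End ℂ (Smooth n)) (s : Finset ι)
    (f : ι → Polynomial (Pol n)) : gradedQ Q (∑ i ∈ s, f i) = ∑ i ∈ s, gradedQ Q (f i) :=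
  map_sum (⟨⟨gradedQ Q, gradedQ_zero Q⟩, gradedQ_add Q⟩ :
    Polynomial (Pol n) →+ Polynomial (Module.End ℂ (Smooth n))) f s

theorem gradedQ_monomial (Q : Pol n →ₗ[ℂ] Module.End ℂ (Smooth n)) (k : ℕ) {d : ℕ} {χ : Pol n}
    (h : χ.IsHomogeneous d) :
    gradedQ Q (Polynomial.monomial k χ) = Polynomial.monomial (k + d) (Q χ) := by
  ext1 N
  rw [coeff_gradedQ, Polynomial.coeff_monomial]
  have key : ∀ x : ℕ × ℕ, homComp x.2 ((Polynomial.monomial k χ).coeff x.1) =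
      if x = (k, d) then χ else 0 := by
    intro x
    rw [Polynomial.coeff_monomial]
    by_cases h1 : k = x.1
    · rw [if_pos h1, homComp_of_isHomogeneous h]
      simp [Prod.ext_iff, h1]
    · rw [if_neg h1, map_zero, if_neg fun hx => h1 (by rw [hx])]
  rw [Finset.sum_congr rfl fun x _ => key x, Finset.sum_ite_eq']
  simp only [Finset.HasAntidiagonal.mem_antidiagonal]
  split_ifs <;> simp

theorem gradedQ_C (Q : Pol n →ₗ[ℂ] Module.End ℂ (Smooth n)) {d : ℕ} {χ : Pol n}
    (h : χ.IsHomogeneous d) :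
    gradedQ Q (Polynomial.C χ) = Polynomial.monomial d (Q χ) := by
  rw [← Polynomial.monomial_zero_left, gradedQ_monomial Q 0 h, zero_add]

/-- Within the coefficient of t^N, distinct powers of t in Φ contribute symbols of distinct degrees.
Hence the component of degree d of the coefficient of t^k can be read off at N = k + d. -/
theorem gradedQ_injective {Q : Pol n →ₗ[ℂ] Module.End ℂ (Smooth n)} (hQ : Function.Injective Q) :
    Function.Injective (gradedQ Q) := by
  have key : ∀ (Φ : Polynomial (Pol n)) (k d : ℕ),
      homComp d (∑ x ∈ Finset.HasAntidiagonal.antidiagonal (k + d), homComp x.2 (Φ.coeff x.1)) =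
        homComp d (Φ.coeff k) := by
    intro Φ k d
    rw [map_sum, Finset.sum_eq_single_of_mem (k, d)
      (Finset.HasAntidiagonal.mem_antidiagonal.2 rfl)]
    · rw [homComp_homComp, if_pos rfl]
    · intro x hx hne
      have hx' := Finset.HasAntidiagonal.mem_antidiagonal.1 hx
      rw [homComp_homComp, if_neg]
      intro h
      exact hne (Prod.ext (by simp only; omega) h.symm)
  intro Φ Ψ h
  ext1 k
  ext1 a
  have h1 := congrArg (fun P => P.coeff (k + a.degree)) h
  simp only [coeff_gradedQ] at h1
  have h2 := congrArg (homComp a.degree) (hQ h1)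
  rw [key, key] at h2
  have h3 := congrArg (MvPolynomial.coeff a) h2
  rwa [coeff_homComp, coeff_homComp, if_pos rfl, if_pos rfl] at h3

/-- The star product of homogeneous symbols from the symbol of the composition. -/
theorem gradedQ_sum_monomial_homComp (Q : Pol n →ₗ[ℂ] Module.End ℂ (Smooth n)) {a b : ℕ}
    {φ ψ W : Pol n} (hφ : φ.IsHomogeneous a) (hψ : ψ.IsHomogeneous b)
    (hW : W ∈ degLT n (a + b + 1)) (h : Q W = Q φ * Q ψ) :
    gradedQ Q (∑ m ∈ Finset.range (a + b + 1), Polynomial.monomial (a + b - m) (homComp m W)) =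
      gradedQ Q (Polynomial.C φ) * gradedQ Q (Polynomial.C ψ) := by
  rw [gradedQ_sum, gradedQ_C Q hφ, gradedQ_C Q hψ, Polynomial.monomial_mul_monomial, ← h]
  nth_rewrite 2 [← sum_homComp hW]
  rw [map_sum, map_sum]
  refine Finset.sum_congr rfl fun m hm => ?_
  rw [gradedQ_monomial Q _ (homComp_isHomogeneous m W)]
  rw [Nat.sub_add_cancel (Nat.le_of_lt_succ (Finset.mem_range.1 hm))]

theorem dequant_mem_degLT (l : ℂ) {m : ℕ} {φ : Pol n} (h : φ ∈ degLT n m) :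
    dequant l φ ∈ degLT n m := by
  have h1 := Submodule.add_mem _ (degLT_mono (Nat.sub_le m 1) (dequant_sub_mem_degLT l h)) h
  rwa [sub_add_cancel] at h1

theorem mul_add_sum_mem_degLT {a b : ℕ} {φ ψ r : Pol n} (hφ : φ ∈ degLT n (a + 1))
    (hψ : ψ ∈ degLT n (b + 1)) (hr : r ∈ degLT n (a + b - 1)) :
    φ * ψ + ∑ i, derXi i φ * derU i ψ + r ∈ degLT n (a + b + 1) := by
  refine Submodule.add_mem _ (Submodule.add_mem _ (degLT_mono (by omega) (mul_mem_degLT hφ hψ))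
    (Submodule.sum_mem _ fun i _ => ?_)) (degLT_mono (by omega) hr)
  exact degLT_mono (by omega) (mul_mem_degLT (derXi_mem_degLT hφ i) (derU_mem_degLT hψ i))

theorem IsEquivariantQuantization.exists_mul {l : ℂ} {Q : Pol n →ₗ[ℂ] Module.End ℂ (Smooth n)}
    (hQ : IsEquivariantQuantization n l Q) {a b : ℕ} {φ ψ : Pol n}
    (hφ : φ.IsHomogeneous a) (hψ : ψ.IsHomogeneous b) :
    ∃ W ∈ degLT n (a + b + 1), Q W = Q φ * Q ψ := by
  obtain ⟨φ', hφ', rfl⟩ := exists_dequant_eq l (mem_degLT_of_isHomogeneous hφ)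
  obtain ⟨ψ', hψ', rfl⟩ := exists_dequant_eq l (mem_degLT_of_isHomogeneous hψ)
  obtain ⟨r, hr, e⟩ := hasFirstOrderComp_of_mem_degLT hφ' b ψ' hψ'
  exact ⟨_, dequant_mem_degLT l (mul_add_sum_mem_degLT hφ' hψ' hr), by
    rw [hQ.apply_dequant, hQ.apply_dequant, hQ.apply_dequant, e]⟩

theorem IsEquivariantQuantization.exists_star {l : ℂ} {Q : Pol n →ₗ[ℂ] Module.End ℂ (Smooth n)}
    (hQ : IsEquivariantQuantization n l Q) (φ ψ : Pol n) :
    ∃ Φ, gradedQ Q Φ = gradedQ Q (Polynomial.C φ) * gradedQ Q (Polynomial.C ψ) := by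
  obtain ⟨a, ha⟩ := exists_mem_degLT φ
  obtain ⟨b, hb⟩ := exists_mem_degLT ψ
  have key : ∀ d e, ∃ Φ, gradedQ Q Φ =
      gradedQ Q (Polynomial.C (homComp d φ)) * gradedQ Q (Polynomial.C (homComp e ψ)) := by
    intro d e
    obtain ⟨W, hW, h⟩ := hQ.exists_mul (homComp_isHomogeneous d φ) (homComp_isHomogeneous e ψ)
    exact ⟨_, gradedQ_sum_monomial_homComp Q (homComp_isHomogeneous d φ)
      (homComp_isHomogeneous e ψ) hW h⟩
  choose F hF using key
  refine ⟨∑ d ∈ Finset.range a, ∑ e ∈ Finset.range b, F d e, ?_⟩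
  rw [← sum_homComp ha, ← sum_homComp hb, map_sum, map_sum, gradedQ_sum, gradedQ_sum,
    gradedQ_sum, Finset.sum_mul_sum]
  simp only [gradedQ_sum, hF]

/-- `starProduct` is defined through `Function.invFun`, which is meaningful only because the product
lies in the range. -/
theorem IsEquivariantQuantization.gradedQ_starProduct {l : ℂ}
    {Q : Pol n →ₗ[ℂ] Module.End ℂ (Smooth n)} (hQ : IsEquivariantQuantization n l Q)
    (φ ψ : Pol n) : gradedQ Q (starProduct Q φ ψ) =
      gradedQ Q (Polynomial.C φ) * gradedQ Q (Polynomial.C ψ) :=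
  Function.invFun_eq (hQ.exists_star φ ψ)

theorem IsEquivariantQuantization.starProduct_eq {l : ℂ}
    {Q : Pol n →ₗ[ℂ] Module.End ℂ (Smooth n)} (hQ : IsEquivariantQuantization n l Q)
    {φ ψ : Pol n} {Φ : Polynomial (Pol n)}
    (h : gradedQ Q Φ = gradedQ Q (Polynomial.C φ) * gradedQ Q (Polynomial.C ψ)) :
    starProduct Q φ ψ = Φ :=
  gradedQ_injective hQ.injective ((hQ.gradedQ_starProduct φ ψ).trans h.symm)

theorem IsEquivariantQuantization.starCoeff_sum_sum {l : ℂ}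
    {Q : Pol n →ₗ[ℂ] Module.End ℂ (Smooth n)} (hQ : IsEquivariantQuantization n l Q) (p : ℕ)
    {ι κ : Type*} (s : Finset ι) (t : Finset κ) (f : ι → Pol n) (g : κ → Pol n) :
    starCoeff Q p (∑ i ∈ s, f i) (∑ j ∈ t, g j) =
      ∑ i ∈ s, ∑ j ∈ t, starCoeff Q p (f i) (g j) := by
  have h : starProduct Q (∑ i ∈ s, f i) (∑ j ∈ t, g j) =
      ∑ i ∈ s, ∑ j ∈ t, starProduct Q (f i) (g j) := by
    apply hQ.starProduct_eq
    simp only [gradedQ_sum, map_sum, hQ.gradedQ_starProduct, Finset.sum_mul_sum]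
  simp only [starCoeff, h, Polynomial.finsetSum_coeff]

/-- The product carries t^(a+b), so the component of degree m of its symbol W must sit at t^(a+b-m).
-/
theorem IsEquivariantQuantization.starCoeff_eq {l : ℂ}
    {Q : Pol n →ₗ[ℂ] Module.End ℂ (Smooth n)} (hQ : IsEquivariantQuantization n l Q) (p : ℕ)
    {a b : ℕ} {φ ψ W : Pol n} (hφ : φ.IsHomogeneous a) (hψ : ψ.IsHomogeneous b)
    (hW : W ∈ degLT n (a + b + 1)) (h : Q W = Q φ * Q ψ) :
    starCoeff Q p φ ψ = if p ≤ a + b then homComp (a + b - p) W else 0 := by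
  rw [starCoeff, hQ.starProduct_eq (gradedQ_sum_monomial_homComp Q hφ hψ hW h)]
  simp only [Polynomial.finsetSum_coeff, Polynomial.coeff_monomial]
  split_ifs with hp
  · rw [Finset.sum_eq_single_of_mem (a + b - p) (Finset.mem_range.2 (by omega))]
    · rw [if_pos (by omega)]
    · intro m hm hne
      have := Finset.mem_range.1 hm
      rw [if_neg (by omega)]
  · exact Finset.sum_eq_zero fun m _ => if_neg (by omega)

/-! ### The first coefficient for half-densities -/

theorem mul_mem_degLT_of_sub_one {a b : ℕ} {φ ψ : Pol n} (hφ : φ ∈ degLT n (a - 1))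
    (hψ : ψ ∈ degLT n (b + 1)) : φ * ψ ∈ degLT n (a + b - 1) := by
  rcases a with _ | a
  · rw [eq_zero_of_mem_degLT_zero hφ, zero_mul]
    exact Submodule.zero_mem _
  · exact degLT_mono (by omega) (mul_mem_degLT hφ hψ)

/-- At weight 1/2 the numerator is half of the denominator for every degree. For d = 0 and n = 1 the
quotient would be 0/0. -/
theorem dequantCoeff_half_one {d : ℕ} (hd : d ≠ 0) : dequantCoeff n (1 / 2) 1 d = -(1 / 2) := by
  have h : 2 * (d : ℂ) - 1 + n ≠ 0 := by
    have : 2 * (d : ℂ) - 1 + n = ((d - 1 + d + n : ℕ) : ℂ) := by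
      push_cast [Nat.cast_sub (Nat.one_le_iff_ne_zero.2 hd)]
      ring
    rw [this]
    exact Nat.cast_ne_zero.2 (by omega)
  simp only [dequantCoeff, Finset.prod_range_one, Nat.factorial_one, Nat.cast_one, Nat.cast_zero,
    sub_zero, pow_one]
  rw [show (d : ℂ) - 1 + 1 / 2 * (n + 1) = 1 / 2 * (2 * d - 1 + n) by ring, mul_div_assoc,
    div_self h]
  ring

theorem dequant_half_mem_degLT_of_isHomogeneous {d : ℕ} {φ : Pol n} (h : φ.IsHomogeneous d) :
    dequant (1 / 2) φ - φ + (1 / 2 : ℂ) • divergence φ ∈ degLT n (d - 1) := by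
  have hmem := mem_degLT_of_isHomogeneous h
  rcases d with _ | d
  · have h0 := eq_zero_of_mem_degLT_zero (divergence_mem_degLT hmem)
    have h1 := eq_zero_of_mem_degLT_zero (dequant_sub_mem_degLT (1 / 2) hmem)
    rw [h0, h1, smul_zero, add_zero]
    exact Submodule.zero_mem _
  · rw [dequant_of_isHomogeneous _ h, Finset.sum_range_succ', Finset.sum_range_succ',
      dequantCoeff_zero, zero_add, dequantCoeff_half_one d.succ_ne_zero, pow_zero, pow_one, one_smul,
      Module.End.one_apply, add_sub_cancel_right, add_assoc, ← add_smul, neg_add_cancel, zero_smul,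
      add_zero]
    refine Submodule.sum_mem _ fun k _ => Submodule.smul_mem _ _ ?_
    exact degLT_mono (by omega) (divergence_pow_mem_degLT hmem (k + 1 + 1))

theorem dequant_half_mem_degLT {m : ℕ} {φ : Pol n} (h : φ ∈ degLT n m) :
    dequant (1 / 2) φ - φ + (1 / 2 : ℂ) • divergence φ ∈ degLT n (m - 2) := by
  have hsum : dequant (1 / 2) φ - φ + (1 / 2 : ℂ) • divergence φ = ∑ d ∈ Finset.range m,
      (dequant (1 / 2) (homComp d φ) - homComp d φ +
        (1 / 2 : ℂ) • divergence (homComp d φ)) := by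
    rw [Finset.sum_add_distrib, Finset.sum_sub_distrib, ← Finset.smul_sum, ← map_sum, ← map_sum,
      sum_homComp h]
  rw [hsum]
  refine Submodule.sum_mem _ fun d hd => ?_
  have := Finset.mem_range.1 hd
  exact degLT_mono (by omega)
    (dequant_half_mem_degLT_of_isHomogeneous (homComp_isHomogeneous d φ))

/-- The normally ordered symbol of the quantization on half-densities, up to two orders. -/
theorem exists_dequant_half_eq {a : ℕ} {φ : Pol n} (h : φ.IsHomogeneous a) :
    ∃ φ' ∈ degLT n (a + 1), dequant (1 / 2) φ' = φ ∧ φ' - φ ∈ degLT n a ∧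
      φ' - φ - (1 / 2 : ℂ) • divergence φ ∈ degLT n (a - 1) := by
  obtain ⟨φ', hφ', e⟩ := exists_dequant_eq (1 / 2) (mem_degLT_of_isHomogeneous h)
  have h1 : φ' - φ ∈ degLT n a := by
    have := Submodule.neg_mem _ (dequant_sub_mem_degLT (1 / 2) hφ')
    rwa [neg_sub, e] at this
  refine ⟨φ', hφ', e, h1, ?_⟩
  have h2 := dequant_half_mem_degLT hφ'
  have h3 := Submodule.smul_mem _ (1 / 2 : ℂ) (divergence_mem_degLT h1)
  rw [e] at h2
  have h4 := Submodule.sub_mem _ h3 h2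
  rw [map_sub, smul_sub] at h4
  have e2 : φ' - φ - (1 / 2 : ℂ) • divergence φ = (1 / 2 : ℂ) • divergence φ' -
      (1 / 2 : ℂ) • divergence φ - (φ - φ' + (1 / 2 : ℂ) • divergence φ') := by ring
  rw [e2]
  exact h4

/-- Stating the degree as an Euler eigenvalue avoids the truncation of `a + b - 1`. -/
theorem euler_poisson {a b : ℕ} {φ ψ : Pol n} (hφ : φ.IsHomogeneous a) (hψ : ψ.IsHomogeneous b) :
    euler (poisson φ ψ) = ((a : ℂ) + b - 1) • poisson φ ψ := by
  have hXi : ∀ {c : ℕ} {χ : Pol n}, χ.IsHomogeneous c → ∀ i,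
      euler (derXi i χ) = ((c : ℂ) - 1) • derXi i χ := fun hχ i =>
    euler_projG_of_eigen (euler_of_isHomogeneous hχ) i.succ
  have hU : ∀ {c : ℕ} {χ : Pol n}, χ.IsHomogeneous c → ∀ i,
      euler (derU i χ) = (c : ℂ) • derU i χ := fun hχ i => by
    rw [euler_derU, euler_of_isHomogeneous hχ, Derivation.map_smul]
  rw [poisson_eq, map_sum, Finset.smul_sum]
  refine Finset.sum_congr rfl fun i _ => ?_
  simp only [map_sub, Derivation.leibniz, hXi hφ, hXi hψ, hU hφ, hU hψ, smul_eq_mul,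
    Algebra.smul_def, map_add, map_one]
  ring

theorem poisson_isHomogeneous {a b : ℕ} {φ ψ : Pol n} (hφ : φ.IsHomogeneous a)
    (hψ : ψ.IsHomogeneous b) (h : 1 ≤ a + b) : (poisson φ ψ).IsHomogeneous (a + b - 1) := by
  apply isHomogeneous_of_euler
  rw [euler_poisson hφ hψ, Nat.cast_sub h]
  push_cast
  rfl

theorem poisson_of_isHomogeneous_zero {φ ψ : Pol n} (hφ : φ.IsHomogeneous 0)
    (hψ : ψ.IsHomogeneous 0) : poisson φ ψ = 0 := by
  have h : ∀ {χ : Pol n}, χ.IsHomogeneous 0 → ∀ i, derXi i χ = 0 := fun hχ i =>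
    projG_of_isHomogeneous_zero hχ i.succ
  simp [poisson_eq, h hφ, h hψ]

/-- Modulo degree a + b - 1, φ and ψ have normally ordered symbols (1 + D/2)φ and (1 + D/2)ψ, and
the composition is dequantized by 1 - D/2. The terms with Dφ and Dψ cancel, and the cross terms of
D(φψ) antisymmetrize ∑ ∂φ/∂ξ_i ∂ψ/∂u_i. -/
theorem IsEquivariantQuantization.starCoeff_one_of_isHomogeneous
    {Q : Pol n →ₗ[ℂ] Module.End ℂ (Smooth n)} (hQ : IsEquivariantQuantization n (1 / 2) Q)
    {a b : ℕ} {φ ψ : Pol n} (hφ : φ.IsHomogeneous a) (hψ : ψ.IsHomogeneous b) :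
    starCoeff Q 1 φ ψ = (1 / 2 : ℂ) • poisson φ ψ := by
  obtain ⟨φ', mφ, eφ, dφ, tφ⟩ := exists_dequant_half_eq hφ
  obtain ⟨ψ', mψ, eψ, dψ, tψ⟩ := exists_dequant_half_eq hψ
  obtain ⟨r, hr, e⟩ := hasFirstOrderComp_of_mem_degLT mφ b ψ' mψ
  have hφm := mem_degLT_of_isHomogeneous hφ
  have hψm := mem_degLT_of_isHomogeneous hψ
  set V := φ' * ψ' + ∑ i, derXi i φ' * derU i ψ' + r with hV
  have hVm : V ∈ degLT n (a + b + 1) := mul_add_sum_mem_degLT mφ mψ hr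
  have hQW : Q (dequant (1 / 2) V) = Q φ * Q ψ := by
    rw [hQ.apply_dequant, ← e, ← eφ, ← eψ, hQ.apply_dequant, hQ.apply_dequant]
  rw [hQ.starCoeff_eq 1 hφ hψ (dequant_mem_degLT _ hVm) hQW]
  by_cases hab : 1 ≤ a + b
  swap
  -- For two functions of u alone `a + b - 1` would truncate; here both sides are zero.
  · obtain ⟨rfl, rfl⟩ : a = 0 ∧ b = 0 := by omega
    rw [if_neg (by omega), poisson_of_isHomogeneous_zero hφ hψ, smul_zero]
  rw [if_pos hab]
  have hprod : φ' * ψ' - (φ * ψ + (1 / 2 : ℂ) • divergence φ * ψ +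
      φ * (1 / 2 : ℂ) • divergence ψ) ∈ degLT n (a + b - 1) := by
    have hDφ := Submodule.smul_mem _ (1 / 2 : ℂ) (divergence_mem_degLT hφm)
    have hDψ := Submodule.smul_mem _ (1 / 2 : ℂ) (divergence_mem_degLT hψm)
    have h1 := mul_mem_degLT_of_sub_one tφ mψ
    have h2 := mul_mem_degLT_of_sub_one tψ
      (Submodule.add_mem _ hφm (degLT_mono (Nat.le_succ a) hDφ))
    rw [add_comm b a] at h2
    have h3 := mul_mem_degLT hDφ hDψ
    have h4 := Submodule.add_mem _ (Submodule.add_mem _ h1 h2) h3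
    convert h4 using 1
    generalize (1 / 2 : ℂ) • divergence φ = x
    generalize (1 / 2 : ℂ) • divergence ψ = y
    ring
  have hsum : ∑ i, derXi i φ' * derU i ψ' - ∑ i, derXi i φ * derU i ψ ∈
      degLT n (a + b - 1) := by
    rw [← Finset.sum_sub_distrib]
    refine Submodule.sum_mem _ fun i _ => ?_
    have h1 := mul_mem_degLT_of_sub_one (derXi_mem_degLT dφ i) (derU_mem_degLT mψ i)
    have h2 := mul_mem_degLT (derXi_mem_degLT hφm i) (derU_mem_degLT dψ i)
    have h3 := Submodule.add_mem _ h1 h2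
    rw [map_sub, map_sub] at h3
    convert h3 using 1
    ring
  have hVφψ : V - φ * ψ ∈ degLT n (a + b) := by
    have h1 := degLT_mono (by omega : _ ≤ a + b) (mul_mem_degLT dφ mψ)
    have h2 := degLT_mono (by omega : _ ≤ a + b) (mul_mem_degLT hφm dψ)
    have h3 : ∑ i, derXi i φ' * derU i ψ' ∈ degLT n (a + b) :=
      Submodule.sum_mem _ fun i _ => degLT_mono (by omega)
        (mul_mem_degLT (derXi_mem_degLT mφ i) (derU_mem_degLT mψ i))
    have h4 := Submodule.add_mem _ (Submodule.add_mem _ (Submodule.add_mem _ h1 h2) h3)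
      (degLT_mono (by omega : _ ≤ a + b) hr)
    convert h4 using 1
    rw [hV]
    ring
  have hD := Submodule.smul_mem _ (1 / 2 : ℂ) (divergence_mem_degLT hVφψ)
  have hW : dequant (1 / 2) V - (φ * ψ + (1 / 2 : ℂ) • poisson φ ψ) ∈
      degLT n (a + b - 1) := by
    have h1 := degLT_mono (by omega : _ ≤ a + b - 1) (dequant_half_mem_degLT hVm)
    have h2 := Submodule.sub_mem _ (Submodule.add_mem _ (Submodule.add_mem _
      (Submodule.add_mem _ h1 hprod) hsum) hr) hD
    convert h2 using 1
    have hdiv := divergence_mul φ ψ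
    rw [map_sub, smul_sub, hdiv, poisson_eq]
    simp only [Finset.sum_add_distrib, Finset.sum_sub_distrib]
    generalize divergence φ = Dφ
    generalize divergence ψ = Dψ
    generalize (1 / 2 : ℂ) • divergence V = DV
    generalize dequant (1 / 2) V = W at *
    rw [hV]
    have hhalf : algebraMap ℂ (Pol n) (1 / 2) * 2 = 1 := by
      rw [← map_ofNat (algebraMap ℂ (Pol n)) 2, ← map_mul]
      norm_num
    simp only [Algebra.smul_def]
    generalize ∑ i, derXi i φ' * derU i ψ' = s'
    generalize ∑ i, derXi i φ * derU i ψ = s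
    generalize ∑ i, derU i φ * derXi i ψ = s2
    -- After all cancellations what remains is s - s/2 = s/2.
    linear_combination (-s) * hhalf
  have h0 := homComp_eq_zero_of_mem_degLT hW le_rfl
  rw [map_sub, sub_eq_zero] at h0
  rw [h0, map_add, map_smul, homComp_of_isHomogeneous (hφ.mul hψ), if_neg (by omega), zero_add,
    homComp_of_isHomogeneous (poisson_isHomogeneous hφ hψ hab), if_pos rfl]

theorem poisson_sum_sum {ι κ : Type*} (s : Finset ι) (t : Finset κ) (f : ι → Pol n)
    (g : κ → Pol n) :
    poisson (∑ i ∈ s, f i) (∑ j ∈ t, g j) = ∑ i ∈ s, ∑ j ∈ t, poisson (f i) (g j) := by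
  simp only [poisson_eq, map_sum, Finset.sum_mul_sum, ← Finset.sum_sub_distrib]
  rw [Finset.sum_comm]
  exact Finset.sum_congr rfl fun i _ => Finset.sum_comm

theorem IsEquivariantQuantization.starCoeff_one {Q : Pol n →ₗ[ℂ] Module.End ℂ (Smooth n)}
    (hQ : IsEquivariantQuantization n (1 / 2) Q) (φ ψ : Pol n) :
    starCoeff Q 1 φ ψ = (1 / 2 : ℂ) • poisson φ ψ := by
  obtain ⟨a, ha⟩ := exists_mem_degLT φ
  obtain ⟨b, hb⟩ := exists_mem_degLT ψ
  rw [← sum_homComp ha, ← sum_homComp hb, hQ.starCoeff_sum_sum, poisson_sum_sum]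
  simp only [Finset.smul_sum]
  exact Finset.sum_congr rfl fun d _ => Finset.sum_congr rfl fun e _ =>
    hQ.starCoeff_one_of_isHomogeneous (homComp_isHomogeneous d φ) (homComp_isHomogeneous e ψ)

/-! ### Symbols as functions on the cotangent bundle -/

theorem toFunction_eq_eval₂ (φ : Pol n) (z : (Fin n → ℝ) × (Fin n → ℝ)) :
    φ.toFunction z = MvPolynomial.eval₂ (evalAt z.1) (fun i => (z.2 i : ℂ)) φ := by
  rw [MvPolynomial.eval₂_eq']
  rfl

theorem toFunction_add (φ ψ : Pol n) (z : (Fin n → ℝ) × (Fin n → ℝ)) :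
    (φ + ψ).toFunction z = φ.toFunction z + ψ.toFunction z := by
  simp only [toFunction_eq_eval₂, MvPolynomial.eval₂_add]

theorem toFunction_mul (φ ψ : Pol n) (z : (Fin n → ℝ) × (Fin n → ℝ)) :
    (φ * ψ).toFunction z = φ.toFunction z * ψ.toFunction z := by
  simp only [toFunction_eq_eval₂, MvPolynomial.eval₂_mul]

theorem toFunction_C (f : Smooth n) (z : (Fin n → ℝ) × (Fin n → ℝ)) :
    Pol.toFunction (MvPolynomial.C f) z = f.1 z.1 := by
  rw [toFunction_eq_eval₂, MvPolynomial.eval₂_C]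
  rfl

theorem toFunction_X (i : Fin n) (z : (Fin n → ℝ) × (Fin n → ℝ)) :
    Pol.toFunction (MvPolynomial.X i) z = (z.2 i : ℂ) := by
  rw [toFunction_eq_eval₂, MvPolynomial.eval₂_X]

theorem toFunction_sum {ι : Type*} (s : Finset ι) (f : ι → Pol n)
    (z : (Fin n → ℝ) × (Fin n → ℝ)) :
    (∑ i ∈ s, f i).toFunction z = ∑ i ∈ s, (f i).toFunction z := by
  simp only [toFunction_eq_eval₂, MvPolynomial.eval₂_sum]

theorem toFunction_smul (c : ℂ) (φ : Pol n) (z : (Fin n → ℝ) × (Fin n → ℝ)) :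
    (c • φ).toFunction z = c * φ.toFunction z := by
  rw [Algebra.smul_def, toFunction_mul]
  congr 1
  exact toFunction_C (algebraMap ℂ (Smooth n) c) z

/-- The derivation of symbols along a coordinate direction of `T*ℝⁿ`. -/
noncomputable def derCoord : Fin n ⊕ Fin n → Derivation ℂ (Pol n) (Pol n) :=
  Sum.elim derU derXi

/-- The analytic partial derivatives in `IsBidifferential` are the algebraic derivations, so they
can be computed on symbols. -/
theorem hasFDerivAt_toFunction (φ : Pol n) (z : (Fin n → ℝ) × (Fin n → ℝ)) :
    ∃ L : (Fin n → ℝ) × (Fin n → ℝ) →L[ℝ] ℂ, HasFDerivAt φ.toFunction L z ∧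
      ∀ s, L (direction s) = (derCoord s φ).toFunction z := by
  induction φ using MvPolynomial.induction_on with
  | C f =>
    refine ⟨(fderiv ℝ f.1 z.1).comp (ContinuousLinearMap.fst ℝ _ _), ?_, ?_⟩
    · have h : HasFDerivAt (fun y : (Fin n → ℝ) × (Fin n → ℝ) => f.1 y.1) _ z :=
        (Smooth.differentiable f z.1).hasFDerivAt.comp z hasFDerivAt_fst
      rwa [← funext (toFunction_C f)] at h
    · rintro (i | i)
      · simp only [derCoord, Sum.elim_inl, derU_C, toFunction_C]
        rfl
      · simp only [derCoord, Sum.elim_inr, derXi_C]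
        rw [← map_zero MvPolynomial.C, toFunction_C]
        simp [direction]
  | add φ ψ hφ hψ =>
    obtain ⟨L, hL, eL⟩ := hφ
    obtain ⟨M, hM, eM⟩ := hψ
    refine ⟨L + M, ?_, fun s => ?_⟩
    · have h := hL.add hM
      rwa [show Pol.toFunction φ + Pol.toFunction ψ = Pol.toFunction (φ + ψ) from
        (funext (toFunction_add φ ψ)).symm] at h
    · rw [map_add, toFunction_add, ← eL, ← eM]
      rfl
  | mul_X φ i hφ =>
    obtain ⟨L, hL, eL⟩ := hφ
    have hX : HasFDerivAt (Pol.toFunction (MvPolynomial.X i : Pol n))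
        ((Complex.ofRealCLM.comp (ContinuousLinearMap.proj i)).comp
          (ContinuousLinearMap.snd ℝ (Fin n → ℝ) (Fin n → ℝ))) z := by
      rw [funext (toFunction_X i)]
      exact ((Complex.ofRealCLM.comp (ContinuousLinearMap.proj i)).comp
          (ContinuousLinearMap.snd ℝ (Fin n → ℝ) (Fin n → ℝ))).hasFDerivAt
    have h := hL.mul hX
    rw [show Pol.toFunction φ * Pol.toFunction (MvPolynomial.X i) =
      Pol.toFunction (φ * MvPolynomial.X i) from
      (funext (toFunction_mul φ (MvPolynomial.X i))).symm] at h
    refine ⟨_, h, ?_⟩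
    · rintro (j | j)
      · have := eL (Sum.inl j)
        simp only [derCoord, Sum.elim_inl] at this
        simp [derCoord, derU_X, toFunction_mul, ← this, direction, toFunction_X]
      · have := eL (Sum.inr j)
        simp only [derCoord, Sum.elim_inr] at this
        by_cases hij : j = i
        · subst hij
          simp [derCoord, derXi_X, toFunction_mul, ← this, direction, toFunction_X,
            toFunction_add]
        · simp [derCoord, derXi_X, toFunction_mul, ← this, direction, toFunction_X, hij,
            Ne.symm hij]

theorem iterPartial_toFunction (α : List (Fin n ⊕ Fin n)) (φ : Pol n) :
    iterPartial α φ.toFunction = (α.foldr (fun s => derCoord s) φ).toFunction := by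
  induction α with
  | nil => rfl
  | cons s α ih =>
    funext z
    obtain ⟨L, hL, eL⟩ := hasFDerivAt_toFunction (α.foldr (fun s => derCoord s) φ) z
    rw [iterPartial, ih]
    beta_reduce
    rw [hL.fderiv, eL, List.foldr_cons]

theorem isBidifferential_smul_poisson (c : ℂ) :
    IsBidifferential fun φ ψ : Pol n => c • poisson φ ψ := by
  classical
  refine fun z => ⟨Set.univ, isOpen_univ, Set.mem_univ z,
    Finset.univ.image (fun i : Fin n => ([Sum.inr i], [Sum.inl i])) ∪
      Finset.univ.image (fun i : Fin n => ([Sum.inl i], [Sum.inr i])),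
    -- The sign is read off from whether φ is differentiated along ξ or along u.
    fun s _ => if s.1.head?.any Sum.isRight then c else -c, fun s _ => contDiffOn_const,
    fun φ ψ y _ => ?_⟩
  rw [Finset.sum_union, Finset.sum_image, Finset.sum_image]
  · simp only [iterPartial_toFunction, List.foldr_cons, List.foldr_nil, derCoord, Sum.elim_inl,
      Sum.elim_inr, List.head?_cons, Option.any_some, Sum.isRight_inl, Sum.isRight_inr]
    simp only [toFunction_smul, poisson_eq, sub_eq_add_neg, toFunction_sum, toFunction_add,
      ← neg_one_smul ℂ (derU _ _ * derXi _ _), toFunction_mul, Finset.mul_sum,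
      ← Finset.sum_add_distrib]
    refine Finset.sum_congr rfl fun i _ => ?_
    simp
    ring
  · intro i _ j _ h
    simpa using h
  · intro i _ j _ h
    simpa using h
  · rw [Finset.disjoint_left]
    rintro _ h
    obtain ⟨i, -, rfl⟩ := Finset.mem_image.1 h
    simp

theorem IsEquivariantQuantization.isBidifferential_starCoeff_one
    {Q : Pol n →ₗ[ℂ] Module.End ℂ (Smooth n)} (hQ : IsEquivariantQuantization n (1 / 2) Q) :
    IsBidifferential (starCoeff Q 1) := by
  rw [show starCoeff Q 1 = fun φ ψ => (1 / 2 : ℂ) • poisson φ ψ from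
    funext₂ hQ.starCoeff_one]
  exact isBidifferential_smul_poisson _

/-! ### The coefficients on monomials -/

theorem derXi_X_pow (i : Fin n) (d : ℕ) :
    derXi i (MvPolynomial.X i ^ d : Pol n) = (d : ℂ) • MvPolynomial.X i ^ (d - 1) := by
  rw [Derivation.leibniz_pow, derXi_X, if_pos rfl, smul_eq_mul, mul_one, Nat.cast_smul_eq_nsmul]

theorem derXi_X_pow_of_ne {i j : Fin n} (h : j ≠ i) (d : ℕ) :
    derXi j (MvPolynomial.X i ^ d : Pol n) = 0 := by
  rw [Derivation.leibniz_pow, derXi_X, if_neg h, smul_zero, smul_zero]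

theorem derU_X_pow (i j : Fin n) (d : ℕ) : derU j (MvPolynomial.X i ^ d : Pol n) = 0 := by
  rw [Derivation.leibniz_pow, derU_X, smul_zero, smul_zero]

/-- Only derivatives along ξ_i survive. The constants m and ε depend on β but not on d, and the
falling factorial is a polynomial in d. -/
theorem foldr_derCoord_X_pow (i : Fin n) (β : List (Fin n ⊕ Fin n)) :
    ∃ (m : ℕ) (ε : ℂ), ∀ d : ℕ, β.foldr (fun s => derCoord s) (MvPolynomial.X i ^ d : Pol n) =
      (ε * d.descFactorial m) • MvPolynomial.X i ^ (d - m) := by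
  induction β with
  | nil => exact ⟨0, 1, fun d => by simp⟩
  | cons s β ih =>
    obtain ⟨m, ε, h⟩ := ih
    rcases s with j | j
    · exact ⟨0, 0, fun d => by
        rw [List.foldr_cons, h, Derivation.map_smul, derCoord, Sum.elim_inl, derU_X_pow,
          smul_zero, zero_mul, zero_smul]⟩
    by_cases hji : j = i
    · refine ⟨m + 1, ε, fun d => ?_⟩
      rw [List.foldr_cons, h, Derivation.map_smul, derCoord, Sum.elim_inr, hji, derXi_X_pow,
        smul_smul, Nat.descFactorial_succ, Nat.sub_sub, Nat.cast_mul, mul_assoc,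
        mul_comm (d.descFactorial m : ℂ)]
    · exact ⟨0, 0, fun d => by
        rw [List.foldr_cons, h, Derivation.map_smul, derCoord, Sum.elim_inr,
          derXi_X_pow_of_ne hji, smul_zero, zero_mul, zero_smul]⟩

theorem toFunction_smul_X_pow_one (c : ℂ) (i : Fin n) (d : ℕ) (u : Fin n → ℝ) :
    Pol.toFunction (c • MvPolynomial.X i ^ d) (u, 1) = c := by
  rw [toFunction_smul, toFunction_eq_eval₂, MvPolynomial.eval₂_pow, MvPolynomial.eval₂_X]
  simp

theorem exists_polynomial_iterPartial_X_pow (i : Fin n) (β : List (Fin n ⊕ Fin n)) :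
    ∃ P : Polynomial ℂ, ∀ d : ℕ,
      iterPartial β (Pol.toFunction (MvPolynomial.X i ^ d)) (0, 1) = P.eval (d : ℂ) := by
  obtain ⟨m, ε, h⟩ := foldr_derCoord_X_pow i β
  refine ⟨Polynomial.C ε * descPochhammer ℂ m, fun d => ?_⟩
  rw [iterPartial_toFunction, h, toFunction_smul_X_pow_one, Polynomial.eval_mul,
    Polynomial.eval_C, descPochhammer_eval_eq_descFactorial]

theorem divergence_coord_pow_mul_X_pow (i : Fin n) (a b : ℕ) :
    divergence (MvPolynomial.C (coord i ^ a) * MvPolynomial.X i ^ b) =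
      ((a : ℂ) * b) • (MvPolynomial.C (coord i ^ (a - 1)) * MvPolynomial.X i ^ (b - 1)) := by
  rw [divergence_apply, Finset.sum_eq_single i]
  · rw [map_pow, Derivation.leibniz, derXi_X_pow, Derivation.leibniz_pow, derXi_C, smul_zero,
      smul_zero, smul_zero, add_zero, smul_eq_mul, mul_smul_comm, Derivation.map_smul,
      Derivation.leibniz, derU_X_pow, smul_zero, zero_add, Derivation.leibniz_pow, derU_coord,
      if_pos rfl, smul_eq_mul, smul_eq_mul, mul_one, ← Nat.cast_smul_eq_nsmul ℂ, mul_smul_comm,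
      smul_smul, mul_comm (b : ℂ), mul_comm (MvPolynomial.X i ^ (b - 1)), map_pow]
  · intro j _ hj
    rw [Derivation.leibniz, derXi_X_pow_of_ne hj, derXi_C, smul_zero, smul_zero, add_zero,
      map_zero]
  · simp

theorem divergence_pow_coord_pow_mul_X_pow (i : Fin n) (a b k : ℕ) :
    (divergence ^ k) (MvPolynomial.C (coord i ^ a) * MvPolynomial.X i ^ b) =
      ((a.descFactorial k : ℂ) * b.descFactorial k) •
        (MvPolynomial.C (coord i ^ (a - k)) * MvPolynomial.X i ^ (b - k)) := by
  induction k with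
  | zero => simp
  | succ k ih =>
    rw [pow_succ', Module.End.mul_apply, ih, map_smul, divergence_coord_pow_mul_X_pow, smul_smul,
      Nat.descFactorial_succ, Nat.descFactorial_succ, Nat.sub_sub, Nat.sub_sub]
    push_cast
    congr 1
    ring

theorem isHomogeneous_C_mul_X_pow (f : Smooth n) (i : Fin n) (d : ℕ) :
    (MvPolynomial.C f * MvPolynomial.X i ^ d : Pol n).IsHomogeneous d := by
  have h := (MvPolynomial.isHomogeneous_C (Fin n) f).mul (MvPolynomial.isHomogeneous_X_pow i d)
  rwa [zero_add] at h

theorem dequant_C (l : ℂ) (f : Smooth n) : dequant l (MvPolynomial.C f) = MvPolynomial.C f := by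
  rw [dequant_of_isHomogeneous l (MvPolynomial.isHomogeneous_C (Fin n) f)]
  simp [dequantCoeff_zero]

theorem dequant_X_pow (l : ℂ) (i : Fin n) (d : ℕ) :
    dequant l (MvPolynomial.X i ^ d : Pol n) = MvPolynomial.X i ^ d := by
  rw [dequant_of_isHomogeneous l (MvPolynomial.isHomogeneous_X_pow i d),
    Finset.sum_eq_single_of_mem 0 (by simp), dequantCoeff_zero, one_smul, pow_zero,
    Module.End.one_apply]
  intro k _ hk
  have h := divergence_pow_coord_pow_mul_X_pow i 0 d k
  rw [Nat.descFactorial_of_lt (Nat.pos_of_ne_zero hk), Nat.cast_zero, zero_mul, zero_smul,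
    pow_zero, map_one, one_mul] at h
  rw [h, smul_zero]

/-- D^k lowers the degree by exactly k, so only the term k = p contributes, and D^p removes u_i
completely. -/
theorem homComp_dequant_coord_pow_mul_X_pow (l : ℂ) (i : Fin n) {p d : ℕ} (hp : p ≤ d) :
    homComp (d - p) (dequant l (MvPolynomial.C (coord i ^ p) * MvPolynomial.X i ^ d)) =
      (dequantCoeff n l p d * (p.factorial * d.descFactorial p)) • MvPolynomial.X i ^ (d - p) := by
  rw [dequant_of_isHomogeneous l (isHomogeneous_C_mul_X_pow _ i d), map_sum,
    Finset.sum_eq_single_of_mem p (Finset.mem_range.2 (by omega))]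
  · rw [divergence_pow_coord_pow_mul_X_pow, map_smul, map_smul,
      homComp_of_isHomogeneous (isHomogeneous_C_mul_X_pow _ i (d - p)), if_pos rfl, smul_smul,
      Nat.sub_self, pow_zero, map_one, one_mul, Nat.descFactorial_self]
  · intro k hk hkp
    have := Finset.mem_range.1 hk
    rw [divergence_pow_coord_pow_mul_X_pow, map_smul, map_smul,
      homComp_of_isHomogeneous (isHomogeneous_C_mul_X_pow _ i (d - k)), if_neg (by omega),
      smul_zero, smul_zero]

/-- The two operators are multiplication by u_i^p and ∂_i^d, whose product is already normally
ordered. -/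
theorem IsEquivariantQuantization.starCoeff_coord_pow_X_pow {l : ℂ}
    {Q : Pol n →ₗ[ℂ] Module.End ℂ (Smooth n)} (hQ : IsEquivariantQuantization n l Q)
    (i : Fin n) (p d : ℕ) :
    starCoeff Q p (MvPolynomial.C (coord i ^ p)) (MvPolynomial.X i ^ d) =
      (dequantCoeff n l p d * (p.factorial * d.descFactorial p)) • MvPolynomial.X i ^ (d - p) := by
  have hW : Q (dequant l (MvPolynomial.C (coord i ^ p) * MvPolynomial.X i ^ d)) =
      Q (MvPolynomial.C (coord i ^ p)) * Q (MvPolynomial.X i ^ d) := by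
    have h1 := hQ.apply_dequant (MvPolynomial.C (coord i ^ p))
    have h2 := hQ.apply_dequant (MvPolynomial.X i ^ d)
    rw [dequant_C] at h1
    rw [dequant_X_pow] at h2
    rw [hQ.apply_dequant, h1, h2, diffOp_C_mul, diffOp_C]
  have hmem := dequant_mem_degLT l
    (mem_degLT_of_isHomogeneous (isHomogeneous_C_mul_X_pow (coord i ^ p) i d))
  rw [← zero_add d] at hmem
  rw [hQ.starCoeff_eq p (MvPolynomial.isHomogeneous_C (Fin n) _)
    (MvPolynomial.isHomogeneous_X_pow i d) (by simpa using hmem) hW, zero_add]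
  split_ifs with h
  · exact homComp_dequant_coord_pow_mul_X_pow l i h
  · rw [Nat.descFactorial_of_lt (by omega), Nat.cast_zero, mul_zero, mul_zero, zero_smul]

/-! ### Non-polynomiality of the coefficients in the degree -/

theorem cast_descFactorial_eq_prod (d p : ℕ) :
    (d.descFactorial p : ℂ) = ∏ i ∈ Finset.range p, ((d : ℂ) - i) := by
  rw [← descPochhammer_eval_eq_descFactorial, descPochhammer_eval_eq_prod_range]

theorem eq_half_of_polynomial {l : ℂ} {p : ℕ} (hp : 1 ≤ p) (P : Polynomial ℂ)
    (hP : ∀ d : ℕ, P.eval (d : ℂ) = dequantCoeff n l p d * (p.factorial * d.descFactorial p)) :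
    l = 1 / 2 ∧ p = 1 := by
  -- P vanishes at d = 0, …, p - 1 because of the falling factorial, even where a denominator
  -- vanishes too. So the falling factorial divides P and cannot serve to cancel poles.
  obtain ⟨S, hS⟩ : ∏ i ∈ Finset.range p, (Polynomial.X - Polynomial.C (i : ℂ)) ∣ P := by
    refine Finset.prod_dvd_of_coprime (fun i _ j _ hij => ?_) fun i hi => ?_
    · exact Polynomial.pairwise_coprime_X_sub_C (s := fun i : ℕ => (i : ℂ)) Nat.cast_injective hij
    · rw [Polynomial.dvd_iff_isRoot, Polynomial.IsRoot, hP,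
        Nat.descFactorial_of_lt (Finset.mem_range.1 hi), Nat.cast_zero, mul_zero, mul_zero]
  have hid : S * ∏ i ∈ Finset.range p, (2 * Polynomial.X - Polynomial.C ((p : ℂ) + i - n)) =
      Polynomial.C ((-1) ^ p) *
        ∏ i ∈ Finset.range p, (Polynomial.X - Polynomial.C (1 + (i : ℂ) - l * (n + 1))) := by
    -- For d ≥ p the falling factorial and the denominators are nonzero and can be cleared; these d
    -- are infinitely many.
    refine Polynomial.eq_of_infinite_eval_eq _ _
      (((Set.Ici_infinite p).image (Nat.cast_injective (R := ℂ)).injOn).mono ?_)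
    rintro _ ⟨d, hd : p ≤ d, rfl⟩
    have h := hP d
    have hdf : (d.descFactorial p : ℂ) ≠ 0 :=
      Nat.cast_ne_zero.2 (Nat.descFactorial_eq_zero_iff_lt.not.2 (by omega))
    have hpf : (p.factorial : ℂ) ≠ 0 := Nat.cast_ne_zero.2 p.factorial_ne_zero
    have hden : ∏ i ∈ Finset.range p, (2 * (d : ℂ) - p - i + n) ≠ 0 := by
      refine Finset.prod_ne_zero_iff.2 fun i hi => ?_
      have hi := Finset.mem_range.1 hi
      rw [show 2 * (d : ℂ) - p - i + n = ((2 * d - p - i + n : ℕ) : ℂ) by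
        push_cast [Nat.cast_sub (by omega : p ≤ 2 * d), Nat.cast_sub (by omega : i ≤ 2 * d - p)]
        ring]
      exact Nat.cast_ne_zero.2 (by omega)
    rw [hS, Polynomial.eval_mul, Polynomial.eval_prod] at h
    simp only [Polynomial.eval_sub, Polynomial.eval_X, Polynomial.eval_C] at h
    rw [← cast_descFactorial_eq_prod, mul_comm, ← mul_assoc] at h
    have h2 := mul_right_cancel₀ hdf h
    rw [dequantCoeff, Finset.prod_div_distrib, div_mul_div_comm, div_mul_eq_mul_div,
      eq_div_iff (mul_ne_zero hpf hden), ← mul_assoc, mul_right_comm] at h2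
    have h3 := mul_right_cancel₀ hpf h2
    simp only [Set.mem_ofPred_eq, Polynomial.eval_mul, Polynomial.eval_prod, Polynomial.eval_sub,
      Polynomial.eval_X, Polynomial.eval_C, Polynomial.eval_ofNat]
    calc _ = _ := by
          congr 1
          exact Finset.prod_congr rfl fun i _ => by ring
      _ = _ := h3
      _ = _ := by
          congr 1
          exact Finset.prod_congr rfl fun i _ => by ring
  -- Each zero (p + j - n)/2 of the denominator must be a zero of the numerator.
  have hroot : ∀ j < p, ∃ i < p, (p : ℂ) + j - n = 2 * (1 + i - l * (n + 1)) := by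
    intro j hj
    have h := congrArg (Polynomial.eval (((p : ℂ) + j - n) / 2)) hid
    rw [Polynomial.eval_mul, Polynomial.eval_mul, Polynomial.eval_prod,
      Finset.prod_eq_zero (Finset.mem_range.2 hj), mul_zero, Polynomial.eval_C, eq_comm,
      mul_eq_zero, or_iff_right (pow_ne_zero _ (by norm_num)), Polynomial.eval_prod,
      Finset.prod_eq_zero_iff] at h
    · obtain ⟨i, hi, e⟩ := h
      refine ⟨i, Finset.mem_range.1 hi, ?_⟩
      rw [Polynomial.eval_sub, Polynomial.eval_X, Polynomial.eval_C] at e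
      linear_combination 2 * e
    · simp
      ring
  obtain ⟨i, hi, e⟩ := hroot 0 (by omega)
  -- For p ≥ 2 the zeros for j = 0 and j = 1 differ by 1/2, but zeros of the numerator differ by
  -- integers.
  have hp1 : p = 1 := by
    by_contra hne
    obtain ⟨j, hj, e'⟩ := hroot 1 (by omega)
    have h : ((2 * j : ℤ) : ℂ) = ((2 * i + 1 : ℤ) : ℂ) := by
      push_cast at e e' ⊢
      linear_combination e - e'
    have := Int.cast_injective h
    omega
  refine ⟨?_, hp1⟩
  obtain rfl : i = 0 := by omega
  subst hp1
  have hn : (n : ℂ) + 1 ≠ 0 := Nat.cast_add_one_ne_zero n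
  apply mul_right_cancel₀ hn
  push_cast at e
  linear_combination (1 / 2) * e

/-- The test point is u = 0, ξ = (1, …, 1), where the powers of ξ_i drop out. The finite set of
terms there is fixed while d varies, so the value is a polynomial in d. -/
theorem IsEquivariantQuantization.eq_half_of_isBidifferential {l : ℂ}
    {Q : Pol n →ₗ[ℂ] Module.End ℂ (Smooth n)} (hQ : IsEquivariantQuantization n l Q)
    (hn : 1 ≤ n) {p : ℕ} (hp : 1 ≤ p) (h : IsBidifferential (starCoeff Q p)) :
    l = 1 / 2 ∧ p = 1 := by
  obtain ⟨U, -, hU, S, c, -, hB⟩ := h (0, 1)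
  let i : Fin n := ⟨0, hn⟩
  choose R hR using exists_polynomial_iterPartial_X_pow i
  refine eq_half_of_polynomial (n := n) hp (∑ s ∈ S, Polynomial.C (c s (0, 1) *
    iterPartial s.1 (Pol.toFunction (MvPolynomial.C (coord i ^ p))) (0, 1)) * R s.2) fun d => ?_
  have h := hB (MvPolynomial.C (coord i ^ p)) (MvPolynomial.X i ^ d) (0, 1) hU
  rw [hQ.starCoeff_coord_pow_X_pow, toFunction_smul_X_pow_one] at h
  rw [h, Polynomial.eval_finsetSum]
  refine Finset.sum_congr rfl fun s _ => ?_
  rw [Polynomial.eval_mul, Polynomial.eval_C, hR]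

end LecomteOvsienko

/-! ### The main theorem. -/

theorem corollary4 (n : ℕ) (hn : 1 ≤ n) :
    -- the quantization map exists and is unique
    (∀ l : ℂ, ∃! Q : LecomteOvsienko.Pol n →ₗ[ℂ] Module.End ℂ (LecomteOvsienko.Smooth n),
      LecomteOvsienko.IsEquivariantQuantization n l Q) ∧
    ∀ (l : ℂ) (Q : LecomteOvsienko.Pol n →ₗ[ℂ] Module.End ℂ (LecomteOvsienko.Smooth n)),
      LecomteOvsienko.IsEquivariantQuantization n l Q →
      -- the star product is well defined
      (∀ φ ψ : LecomteOvsienko.Pol n, ∃! Φ : Polynomial (LecomteOvsienko.Pol n),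
        LecomteOvsienko.gradedQ Q Φ = LecomteOvsienko.gradedQ Q (Polynomial.C φ) *
          LecomteOvsienko.gradedQ Q (Polynomial.C ψ)) ∧
      -- no coefficient is bidifferential, with one exception
      (∀ p : ℕ, 1 ≤ p →
        (LecomteOvsienko.IsBidifferential (LecomteOvsienko.starCoeff Q p) ↔
          l = 1 / 2 ∧ p = 1)) ∧
      -- the exception is half of the Poisson bracket
      (l = 1 / 2 → ∀ φ ψ : LecomteOvsienko.Pol n,
        (2 : ℂ) • LecomteOvsienko.starCoeff Q 1 φ ψ = LecomteOvsienko.poisson φ ψ) := by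
  refine ⟨fun l => ⟨_, LecomteOvsienko.quantization_isEquivariantQuantization l,
    fun Q hQ => hQ.eq_quantization⟩, fun l Q hQ => ⟨fun φ ψ => ?_, fun p hp => ⟨?_, ?_⟩, ?_⟩⟩
  · obtain ⟨Φ, hΦ⟩ := hQ.exists_star φ ψ
    exact ⟨Φ, hΦ, fun Ψ hΨ => LecomteOvsienko.gradedQ_injective hQ.injective (hΨ.trans hΦ.symm)⟩
  · exact hQ.eq_half_of_isBidifferential hn hp
  · rintro ⟨rfl, rfl⟩
    exact hQ.isBidifferential_starCoeff_one
  · rintro rfl φ ψ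
    rw [hQ.starCoeff_one, smul_smul]
    norm_num
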